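/- All rings are commutative with unity. For a ring $R$ we use the following notions. - A module is uniserial if its submodules are totally ordered by inclusion; a valuation ring (zero-divisors allowed) is a ring that is uniserial as a module over itself. $R$ is arithmetical if $R_P$ is a valuation ring for each maximal ideal $P$; coherent if each finitely generated ideal is finitely presented; semihereditary if each finitely generated ideal is projective; clean (respectively almost clean) if each element is the sum of an idempotent and a unit (respectively a regular element, that is, a non-zero-divisor). - $R$ is a torch ring if it is arithmetical with at least two maximal ideals and has a unique minimal prime ideal $N$, and $N$ is a nonzero uniserial module. - $R$ is an IF-ring if each injective $R$-module is flat. $R$ is finitely fractionally IF if, for each finitely generated ideal $A$ of $R$, the classical ring of quotients $Q(R/A)$ (the localization of $R/A$ at all its regular elements) is an IF-ring. - $\mathrm{pSpec}\,R$ is the quotient space of $\mathrm{Spec}\,R$ modulo the equivalence relation generated by inclusion. For $x\in\mathrm{pSpec}\,R$ with $\{x\}$ closed (if $R$ is arithmetical, every point is closed), $A(x)$ is the unique pure ideal with $x=V(A(x))$ as subsets of $\mathrm{Spec}\,R$; explicitly, $A(x)=\bigcap_{P\in x}\ker(R\to R_P)$. Theorem. The following assertions hold: (i) Let $R$ be an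 almost clean coherent arithmetical ring such that, for each $x\in\mathrm{pSpec}\,R$, the ring $R/A(x)$ is either a torch ring, or local, or a domain. Then $R$ is finitely fractionally IF. (ii) Each clean coherent arithmetical ring is finitely fractionally IF. (iii) Each semihereditary ring is finitely fractionally IF. (iv) Let $R$ be a ring of Krull dimension zero or a domain of Krull dimension one. Then $R$ is finitely fractionally IF if and only if $R$ is coherent and arithmetical. -/

import Mathlib

universe u

/-- A module is uniserial if its submodules are totally ordered by inclusion. -/
def IsUniserialModule (R M : Type u) [CommRing R] [AddCommGroup M] [Module R M] : Prop :=
  ∀ A B : Submodule R M, A ≤ B ∨ B ≤ A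

/-- A valuation ring, possibly with zero-divisors: a ring that is uniserial as a module over
itself. (Mathlib's `ValuationRing` is restricted to domains.) -/
def IsUniserialRing (R : Type u) [CommRing R] : Prop :=
  IsUniserialModule R R

/-- A ring is arithmetical if its localization at each maximal ideal is a valuation ring
(possibly with zero-divisors). -/
def IsArithmeticalRing (R : Type u) [CommRing R] : Prop :=
  ∀ (P : Ideal R) [P.IsMaximal], IsUniserialRing (Localization.AtPrime P)

/-- A ring is coherent if each finitely generated ideal is finitely presented. -/
def IsCoherentRing (R : Type u) [CommRing R] : Prop :=
  ∀ I : Ideal R, I.FG → Module.FinitePresentation R I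

/-- A ring is semihereditary if each finitely generated ideal is projective. -/
def IsSemihereditaryRing (R : Type u) [CommRing R] : Prop :=
  ∀ I : Ideal R, I.FG → Module.Projective R I

/-- A ring is clean if each element is the sum of an idempotent and a unit. -/
def IsCleanRing (R : Type u) [CommRing R] : Prop :=
  ∀ a : R, ∃ e s : R, IsIdempotentElem e ∧ IsUnit s ∧ a = e + s

/-- A ring is almost clean if each element is the sum of an idempotent and a regular element
(an element that is not a zero-divisor). -/
def IsAlmostCleanRing (R : Type u) [CommRing R] : Prop :=
  ∀ a : R, ∃ e s : R, IsIdempotentElem e ∧ s ∈ nonZeroDivisors R ∧ a = e + s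

/-- A torch ring: an arithmetical ring with at least two maximal ideals and with a unique minimal
prime ideal, which is nonzero and uniserial. -/
def IsTorchRing (R : Type u) [CommRing R] : Prop :=
  IsArithmeticalRing R ∧ Nontrivial (MaximalSpectrum R) ∧
    ∃ N : Ideal R, minimalPrimes R = {N} ∧ N ≠ ⊥ ∧ IsUniserialModule R N

/-- An IF-ring: each injective module is flat. -/
def IsIFRing (R : Type u) [CommRing R] : Prop :=
  ∀ (M : Type u) [AddCommGroup M] [Module R M], Module.Injective R M → Module.Flat R M

/-- A ring `R` is finitely fractionally IF if the classical ring of quotients (the localization at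
all regular elements) of `R ⧸ A` is an IF-ring for each finitely generated ideal `A`. -/
def IsFinitelyFractionallyIF (R : Type u) [CommRing R] : Prop :=
  ∀ A : Ideal R, A.FG → IsIFRing (FractionRing (R ⧸ A))

/-- The quotient space of the prime spectrum by the equivalence relation generated by inclusion,
with the quotient topology. -/
abbrev PSpec (R : Type u) [CommRing R] : Type u :=
  Quot (fun P Q : PrimeSpectrum R => P ≤ Q)

/-- The natural map from the prime spectrum to its quotient. -/
def toPSpec (R : Type u) [CommRing R] : PrimeSpectrum R → PSpec R :=
  Quot.mk _

/-- The ideal `A(x)` of a point `x`: the intersection of the kernels of `R → R_P` over the primes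
`P` in the class `x`. If `{x}` is closed, this is the unique pure ideal `A` such that
`x = V(A)`: see `pureIdealAt_pure`, `zeroLocus_pureIdealAt` and `eq_pureIdealAt`. -/
def pureIdealAt {R : Type u} [CommRing R] (x : PSpec R) : Ideal R :=
  ⨅ P : {P : PrimeSpectrum R // toPSpec R P = x},
    RingHom.ker (algebraMap R (Localization.AtPrime P.1.asIdeal))

section PureIdealAt

variable {R : Type u} [CommRing R]

theorem toPSpec_eq_of_le {P Q : PrimeSpectrum R} (h : P ≤ Q) : toPSpec R P = toPSpec R Q :=
  Quot.sound h

theorem mem_pureIdealAt {x : PSpec R} (a : R) :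
    a ∈ pureIdealAt x ↔
      ∀ P : PrimeSpectrum R, toPSpec R P = x → ∃ s, s ∉ P.asIdeal ∧ s * a = 0 := by
  simp only [pureIdealAt, Ideal.mem_iInf, RingHom.mem_ker, Subtype.forall]
  refine forall₂_congr fun P _ => ?_
  rw [IsLocalization.map_eq_zero_iff P.asIdeal.primeCompl]
  constructor
  · rintro ⟨m, hm⟩
    exact ⟨m, m.2, hm⟩
  · rintro ⟨s, hs, h⟩
    exact ⟨⟨s, hs⟩, h⟩

theorem mem_pureIdealAt_iff_exists {x : PSpec R} {I : Ideal R}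
    (hI : PrimeSpectrum.zeroLocus (I : Set R) = toPSpec R ⁻¹' {x}) (a : R) :
    a ∈ pureIdealAt x ↔ ∃ i ∈ I, a = a * i := by
  rw [mem_pureIdealAt]
  constructor
  · intro h
    have key : (⊥ : Ideal R).colon {a} ⊔ I = ⊤ := by
      by_contra hne
      obtain ⟨M, hM, hle⟩ := Ideal.exists_le_maximal _ hne
      have hmem : (⟨M, hM.isPrime⟩ : PrimeSpectrum R) ∈ toPSpec R ⁻¹' {x} := by
        rw [← hI]
        exact fun i hi => hle (Ideal.mem_sup_right hi)
      obtain ⟨s, hs, hsa⟩ := h _ hmem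
      exact hs (hle (Ideal.mem_sup_left (by simpa [Submodule.mem_colon_singleton] using hsa)))
    obtain ⟨c, hc, i, hi, hci⟩ := Submodule.mem_sup.1 ((Ideal.eq_top_iff_one _).1 key)
    have hc' : c * a = 0 := by simpa [Submodule.mem_colon_singleton] using hc
    exact ⟨i, hi, by linear_combination (-a) * hci + hc'⟩
  · rintro ⟨i, hi, hai⟩ P hP
    have hiP : i ∈ P.asIdeal := by
      have : P ∈ PrimeSpectrum.zeroLocus (I : Set R) := by rw [hI]; exact hP
      exact this hi
    refine ⟨1 - i, fun h => P.2.ne_top ((Ideal.eq_top_iff_one _).2 ?_), ?_⟩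
    · simpa using P.asIdeal.add_mem h hiP
    · linear_combination hai

theorem zeroLocus_pureIdealAt {x : PSpec R} (hx : IsClosed ({x} : Set (PSpec R))) :
    PrimeSpectrum.zeroLocus (pureIdealAt x : Set R) = toPSpec R ⁻¹' {x} := by
  have hC : IsClosed (toPSpec R ⁻¹' {x}) := hx.preimage continuous_quot_mk
  obtain ⟨I, hI⟩ := (PrimeSpectrum.isClosed_iff_zeroLocus_ideal _).1 hC
  apply Set.Subset.antisymm
  · intro Q hQ
    rw [hI]
    intro i hi
    by_contra hiQ
    let S : Submonoid R :=
      Submonoid.powers i ⊔ Submonoid.comap (Ideal.Quotient.mk I) ⊥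
    have hdisj : Disjoint ((⊥ : Ideal R) : Set R) (S : Set R) := by
      rw [Set.disjoint_left]
      intro z hz hzS
      rw [Submodule.bot_coe, Set.mem_singleton_iff] at hz
      subst hz
      obtain ⟨_, ⟨n, rfl⟩, r, hr, h0⟩ := Submonoid.mem_sup.1 hzS
      have hr' : 1 - r ∈ I := by
        rw [← Ideal.Quotient.eq]
        simpa using (Submonoid.mem_bot.1 (Submonoid.mem_comap.1 hr)).symm
      have : i ^ n ∈ pureIdealAt x := by
        rw [mem_pureIdealAt_iff_exists hI.symm]
        exact ⟨1 - r, hr', by linear_combination h0⟩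
      exact hiQ (Q.2.mem_of_pow_mem n (hQ this))
    obtain ⟨L, hL, -, hLS⟩ := Ideal.exists_le_prime_disjoint _ S hdisj
    have hne : L ⊔ I ≠ ⊤ := by
      intro h
      obtain ⟨l, hl, j, hj, hlj⟩ := Submodule.mem_sup.1 ((Ideal.eq_top_iff_one _).1 h)
      refine Set.disjoint_left.1 hLS hl (Submonoid.mem_sup_right (Submonoid.mem_comap.2 ?_))
      rw [Submonoid.mem_bot, ← map_one (Ideal.Quotient.mk I), Ideal.Quotient.eq]
      have : l - 1 = -j := by linear_combination hlj
      rw [this]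
      exact I.neg_mem hj
    obtain ⟨M, hM, hle⟩ := Ideal.exists_le_maximal _ hne
    have hMC : (⟨M, hM.isPrime⟩ : PrimeSpectrum R) ∈ toPSpec R ⁻¹' {x} := by
      rw [hI]
      exact fun i hi => hle (Ideal.mem_sup_right hi)
    have hLC : (⟨L, hL⟩ : PrimeSpectrum R) ∈ toPSpec R ⁻¹' {x} := by
      have : toPSpec R ⟨L, hL⟩ = toPSpec R ⟨M, hM.isPrime⟩ :=
        toPSpec_eq_of_le (le_sup_left.trans hle : L ≤ M)
      rw [Set.mem_preimage, this]
      exact hMC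
    rw [hI] at hLC
    exact Set.disjoint_left.1 hLS (hLC hi)
      (Submonoid.mem_sup_left (Submonoid.mem_powers i))
  · intro P hP a ha
    obtain ⟨s, hs, hsa⟩ := (mem_pureIdealAt a).1 ha P hP
    exact (P.2.mem_or_mem (hsa ▸ P.asIdeal.zero_mem : s * a ∈ P.asIdeal)).resolve_left hs

theorem pureIdealAt_pure {x : PSpec R} (hx : IsClosed ({x} : Set (PSpec R))) :
    (pureIdealAt x).Pure := by
  refine Ideal.Pure.of_inf_eq_mul _ fun J _ => le_antisymm ?_ Ideal.mul_le_inf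
  rintro a ⟨ha, haJ⟩
  obtain ⟨i, hi, hai⟩ := (mem_pureIdealAt_iff_exists (zeroLocus_pureIdealAt hx) a).1 ha
  rw [hai, mul_comm a i]
  exact Ideal.mul_mem_mul hi haJ

theorem eq_pureIdealAt {x : PSpec R} {A : Ideal R} (hA : A.Pure)
    (h : PrimeSpectrum.zeroLocus (A : Set R) = toPSpec R ⁻¹' {x}) : A = pureIdealAt x := by
  ext a
  rw [mem_pureIdealAt_iff_exists h]
  constructor
  · exact fun ha => Ideal.exists_eq_mul_of_pure ha
  · rintro ⟨i, hi, hai⟩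
    rw [hai]
    exact A.mul_mem_left a hi

end PureIdealAt

/-!
The elements of an arithmetical ring are compared without localizing: any two elements `a`, `b`
satisfy `s a = v b` and `(1 - s) b = w a` for some `s`, `v`, `w` (`IsLocallyComparable`, equivalent
to arithmeticity). At a prime `P`, one of `s`, `1 - s` is a unit, so this says which of `a`, `b`
divides the other there, and finite families are locally dominated by one of their members.

An arithmetical ring `Q` is IF when annihilators of elements are finitely generated and each
principal ideal `(a)` is the annihilator of `(0 : a)` (`isIFRing_of_forall_dvd`): then `Q / a` embeds
in some `Qⁿ`, so an element of an injective module killed by `a` is a combination with coefficients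
in `(0 : a)`, and the equational criterion for flatness can be checked locally, where a relation
reduces to one term. The double annihilator condition holds if non-units of the localizations at
maximal ideals are zero divisors (`dvd_of_forall_mul_eq_zero`). For `Q = Q(R / A)` with `A` finitely
generated and `R` coherent, the localizations to consider are those of `R / A` at the primes `P`
that are maximal among the primes formed by zero divisors.

* If `A_P ≠ 0`, then `A_P` is generated by some `α ≠ 0`, and a non-unit dividing `α` is a zero
  divisor modulo `α` (`exists_mul_mem_of_ne_zero_at`). Non-units not dividing `α` vanish modulo `α`.
* If `A_P = 0`, then `A` is contained in the minimal prime `N` below `P`. Let `B = A(x)` for the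
  class `x` of `P`, which is `V(N)`. As `R` is almost clean, `B` is generated by idempotents, so
  regular elements and annihilators modulo `A` and modulo `A + B` correspond. If the zero divisors of
  `R / (A + B)` form an ideal, this ideal is `P`, and `(R / A)_P` is the ring of quotients of
  `R / (A + B)`, in which non-units are zero divisors
  (`exists_mul_mem_of_zeroDivisorsAddClosedModulo`). They do form an ideal when `R / B` is local, a
  domain, or a torch ring.

Clean rings, semihereditary rings and Prüfer domains are almost clean, and their rings `R / A(x)`
are local, domains and domains respectively; rings of dimension zero are clean.

Conversely, over an IF-ring every finitely presented module embeds in an injective, hence flat,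
module, and so in a finite free one. Hence an IF-ring is coherent, and if `aR ∩ bR = 0`, the
annihilators of `a` and `b` are comaximal. When the primes over `A` are maximal, as for every `A` in
dimension zero and every `A ≠ 0` in a domain of dimension one, `R / A` is its own ring of quotients;
applied to `A = aR ∩ bR`, this gives the comparison of `a` and `b`
(`IsFinitelyFractionallyIF.exists_comparison`).
-/

/-- The elementwise form of arithmeticity: any two elements `a`, `b` divide one another locally,
with a partition of unity `u + (1 - u) = 1` saying where. -/
def IsLocallyComparable (R : Type u) [CommRing R] : Prop :=
  ∀ a b : R, ∃ s v w : R, s * a = v * b ∧ (1 - s) * b = w * a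

/-! ### Elementwise comparison in arithmetical rings -/

section Comparable

variable {R : Type u} [CommRing R]

theorem Ideal.IsPrime.one_sub_notMem {P : Ideal R} (hP : P.IsPrime) {s : R} (hs : s ∈ P) :
    1 - s ∉ P := fun h =>
  hP.ne_top ((Ideal.eq_top_iff_one _).2 (by simpa using P.add_mem h hs))

theorem IsArithmeticalRing.isLocallyComparable (h : IsArithmeticalRing R) :
    IsLocallyComparable R := by
  intro a b
  have key : (Ideal.span {b}).colon {a} ⊔ (Ideal.span {a}).colon {b} = ⊤ := by
    by_contra hne
    obtain ⟨P, hP, hle⟩ := Ideal.exists_le_maximal _ hne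
    have local_dvd : ∀ x y : R,
        Ideal.span {algebraMap R (Localization.AtPrime P) x} ≤
          Ideal.span {algebraMap R (Localization.AtPrime P) y} →
        ∃ t ∉ P, t * x ∈ Ideal.span {y} := by
      intro x y hxy
      rw [Ideal.span_singleton_le_span_singleton] at hxy
      obtain ⟨q, hq⟩ := hxy
      obtain ⟨⟨r, s⟩, hrs⟩ := IsLocalization.surj P.primeCompl q
      have : algebraMap R (Localization.AtPrime P) (s * x) =
          algebraMap R (Localization.AtPrime P) (r * y) := by
        rw [map_mul, map_mul, hq, ← hrs]
        ring
      obtain ⟨t, ht⟩ := (IsLocalization.eq_iff_exists P.primeCompl _).1 this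
      refine ⟨t * s, (t * s).2, Ideal.mem_span_singleton'.2 ⟨t * r, ?_⟩⟩
      linear_combination -ht
    rcases h P (Ideal.span {algebraMap R _ a}) (Ideal.span {algebraMap R _ b}) with hab | hab
    · obtain ⟨t, ht, htab⟩ := local_dvd a b hab
      exact ht (hle (Ideal.mem_sup_left (Submodule.mem_colon_singleton.2 htab)))
    · obtain ⟨t, ht, htab⟩ := local_dvd b a hab
      exact ht (hle (Ideal.mem_sup_right (Submodule.mem_colon_singleton.2 htab)))
  obtain ⟨s, hs, t, ht, hst⟩ := Submodule.mem_sup.1 ((Ideal.eq_top_iff_one _).1 key)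
  obtain ⟨v, hv⟩ := Ideal.mem_span_singleton'.1 (Submodule.mem_colon_singleton.1 hs)
  obtain ⟨w, hw⟩ := Ideal.mem_span_singleton'.1 (Submodule.mem_colon_singleton.1 ht)
  rw [smul_eq_mul] at hv hw
  exact ⟨s, v, w, hv.symm, by rw [← hst, hw]; ring⟩

theorem IsLocallyComparable.isArithmeticalRing (h : IsLocallyComparable R) :
    IsArithmeticalRing R := by
  intro P hP
  have dvd : ∀ x y : Localization.AtPrime P, x ∣ y ∨ y ∣ x := by
    have unit_of : ∀ s : R, s ∉ P → IsUnit (algebraMap R (Localization.AtPrime P) s) :=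
      fun s hs => IsLocalization.map_units (M := P.primeCompl) _ ⟨s, hs⟩
    intro x y
    obtain ⟨⟨a, c⟩, rfl⟩ := IsLocalization.mk'_surjective P.primeCompl x
    obtain ⟨⟨b, d⟩, rfl⟩ := IsLocalization.mk'_surjective P.primeCompl y
    have assoc : ∀ (r : R) (m : P.primeCompl), Associated
        (IsLocalization.mk' (Localization.AtPrime P) r m) (algebraMap R _ r) := fun r m =>
      ⟨(IsLocalization.map_units (Localization.AtPrime P) m).unit, by simp⟩
    rw [(assoc a c).dvd_iff_dvd_left, (assoc b d).dvd_iff_dvd_right,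
      (assoc b d).dvd_iff_dvd_left, (assoc a c).dvd_iff_dvd_right]
    obtain ⟨s, v, w, h1, h2⟩ := h a b
    by_cases hs : s ∈ P
    · left
      rw [← (unit_of _ (hP.isPrime.one_sub_notMem hs)).dvd_mul_left, ← map_mul, h2, map_mul]
      exact dvd_mul_left _ _
    · right
      rw [← (unit_of _ hs).dvd_mul_left, ← map_mul, h1, map_mul]
      exact dvd_mul_left _ _
  intro A B
  by_contra! hAB
  obtain ⟨a, ha, haB⟩ := Set.not_subset.1 hAB.1
  obtain ⟨b, hb, hbA⟩ := Set.not_subset.1 hAB.2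
  rcases dvd a b with ⟨c, rfl⟩ | ⟨c, rfl⟩
  · exact hbA (Ideal.mul_mem_right _ _ ha)
  · exact haB (Ideal.mul_mem_right _ _ hb)

theorem IsLocallyComparable.of_surjective {S : Type u} [CommRing S] (h : IsLocallyComparable R)
    (f : R →+* S) (hf : Function.Surjective f) : IsLocallyComparable S := by
  intro a b
  obtain ⟨a, rfl⟩ := hf a
  obtain ⟨b, rfl⟩ := hf b
  obtain ⟨s, v, w, h1, h2⟩ := h a b
  refine ⟨f s, f v, f w, ?_, ?_⟩
  · rw [← map_mul, h1, map_mul]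
  · rw [← map_one f, ← map_sub, ← map_mul, h2, map_mul]

/-- Locally at a prime, some member of a finite family divides all the others. -/
theorem IsLocallyComparable.exists_dominant (h : IsLocallyComparable R) {P : Ideal R}
    (hP : P.IsPrime) {ι : Type*} (f : ι → R) {F : Finset ι} (hF : F.Nonempty) :
    ∃ j ∈ F, ∃ s ∉ P, ∀ i ∈ F, ∃ d, s * f i = d * f j := by
  induction hF using Finset.Nonempty.cons_induction with
  | singleton a =>
    refine ⟨a, by simp, 1, (Ideal.ne_top_iff_one P).1 hP.ne_top, fun i hi => ⟨1, ?_⟩⟩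
    rw [Finset.mem_singleton.1 hi]
  | cons a F ha hF ih =>
    obtain ⟨j, hj, s, hs, hsd⟩ := ih
    obtain ⟨u, v, w, h1, h2⟩ := h (f a) (f j)
    by_cases hu : u ∈ P
    · refine ⟨a, by simp, s * (1 - u),
        fun hm => (hP.mem_or_mem hm).elim hs (hP.one_sub_notMem hu), fun i hi => ?_⟩
      rcases Finset.mem_cons.1 hi with rfl | hi
      · exact ⟨_, rfl⟩
      · obtain ⟨d, hd⟩ := hsd i hi
        exact ⟨d * w, by linear_combination (1 - u) * hd + d * h2⟩
    · refine ⟨j, by simp [hj], s * u, fun hm => (hP.mem_or_mem hm).elim hs hu, fun i hi => ?_⟩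
      rcases Finset.mem_cons.1 hi with rfl | hi
      · exact ⟨s * v, by linear_combination s * h1⟩
      · obtain ⟨d, hd⟩ := hsd i hi
        exact ⟨u * d, by linear_combination u * hd⟩

end Comparable

/-! ### A criterion for IF-rings -/

section IF

variable {R : Type u} [CommRing R]

/-- If `b₁, …, bₙ` generate the annihilator of `a` and every element killed by all the `bᵢ` is a
multiple of `a`, then `R / a` embeds in `Rⁿ`, so an element of an injective module killed by `a`
is a combination of the `bᵢ`. -/
theorem exists_sum_smul_of_smul_eq_zero {E : Type u} [AddCommGroup E] [Module R E]
    (hE : Module.Injective R E) {a : R} (hfg : ((⊥ : Ideal R).colon {a}).FG)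
    (hann : ∀ c : R, (∀ x, x * a = 0 → c * x = 0) → a ∣ c) {x : E} (hx : a • x = 0) :
    ∃ (n : ℕ) (b : Fin n → R) (y : Fin n → E), (∀ k, b k * a = 0) ∧ x = ∑ k, b k • y k := by
  classical
  obtain ⟨n, b, hb⟩ := Submodule.fg_iff_exists_fin_generating_family.1 hfg
  have hba : ∀ k, b k * a = 0 := fun k => by
    have : b k ∈ (⊥ : Ideal R).colon {a} := hb ▸ Submodule.subset_span ⟨k, rfl⟩
    simpa [Submodule.mem_colon_singleton] using this
  let φ : R →ₗ[R] (Fin n → R) := LinearMap.toSpanSingleton R _ b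
  have hker : LinearMap.ker φ ≤ LinearMap.ker (LinearMap.toSpanSingleton R E x) := by
    intro c hc
    have hc' : ∀ k, c * b k = 0 := fun k => by
      simpa [φ] using congrFun (LinearMap.mem_ker.1 hc) k
    obtain ⟨q, rfl⟩ := hann c fun y hy => by
      have : y ∈ Submodule.span R (Set.range b) := by
        rw [hb]
        simpa [Submodule.mem_colon_singleton] using hy
      obtain ⟨e, rfl⟩ := (Submodule.mem_span_range_iff_exists_fun R).1 this
      rw [Finset.mul_sum]
      exact Finset.sum_eq_zero fun k _ => by
        rw [smul_eq_mul]
        linear_combination e k * hc' k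
    rw [LinearMap.mem_ker, LinearMap.toSpanSingleton_apply, mul_comm, mul_smul, hx, smul_zero]
  obtain ⟨h, hh⟩ := hE.out ((LinearMap.ker φ).liftQ φ le_rfl)
    (LinearMap.ker_eq_bot.1 (Submodule.ker_liftQ_eq_bot' _ _ rfl))
    ((LinearMap.ker φ).liftQ (LinearMap.toSpanSingleton R E x) hker)
  refine ⟨n, b, fun k => h (Pi.single k 1), hba, ?_⟩
  have h1 := hh (Submodule.Quotient.mk 1)
  simp only [Submodule.liftQ_apply, LinearMap.toSpanSingleton_apply, one_smul, φ] at h1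
  rw [← h1]
  conv_lhs => rw [pi_eq_sum_univ' b]
  rw [map_sum]
  refine Finset.sum_congr rfl fun k _ => ?_
  rw [← map_smul]

/-- An arithmetical ring is IF as soon as annihilators of elements are finitely generated and
principal ideals are double annihilators. -/
theorem isIFRing_of_forall_dvd (hR : IsLocallyComparable R)
    (hfg : ∀ a : R, ((⊥ : Ideal R).colon {a}).FG)
    (hann : ∀ a c : R, (∀ x, x * a = 0 → c * x = 0) → a ∣ c) : IsIFRing R := by
  classical
  intro E _ _ hE
  refine Module.Flat.of_forall_isTrivialRelation fun {n f x} hfx => ?_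
  -- `x` is a trivial relation as soon as it lies in `W = K • E`, where `K` are the relations of `f`
  let T : Set (Fin n → E) := {z | ∃ (t : Fin n → R) (y : E), ∑ i, f i * t i = 0 ∧
    z = fun i => t i • y}
  let W : Submodule R (Fin n → E) := Submodule.span R T
  suffices hxW : x ∈ W by
    obtain ⟨k, c, g, hg⟩ := Submodule.mem_span_set'.1 hxW
    choose t y ht hty using fun j => (g j).2
    refine ⟨k, fun i j => t j i, fun j => c j • y j, fun i => ?_, ht⟩
    rw [← hg, Finset.sum_apply]
    refine Finset.sum_congr rfl fun j _ => ?_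
    rw [Pi.smul_apply, hty j, smul_comm]
  by_contra hxW
  have hne : W.colon {x} ≠ ⊤ := fun h => hxW (by
    simpa [Submodule.mem_colon_singleton] using (Ideal.eq_top_iff_one _).1 h)
  obtain ⟨M, hM, hle⟩ := Ideal.exists_le_maximal _ hne
  rcases (Finset.univ : Finset (Fin n)).eq_empty_or_nonempty with hn | hn
  · refine hxW ?_
    have : x = 0 := by
      ext i
      exact absurd (Finset.mem_univ i) (by simp [hn])
    rw [this]
    exact W.zero_mem
  obtain ⟨j, -, s, hs, hd⟩ := hR.exists_dominant hM.isPrime f hn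
  choose d hd using fun i => hd i (Finset.mem_univ i)
  refine hs (hle (Submodule.mem_colon_singleton.2 ?_))
  have hz : f j • ∑ i, d i • x i = 0 := by
    have : ∀ i, f j • d i • x i = s • f i • x i := fun i => by
      rw [smul_smul, smul_smul, hd i, mul_comm]
    rw [Finset.smul_sum, Finset.sum_congr rfl fun i _ => this i, ← Finset.smul_sum, hfx, smul_zero]
  obtain ⟨m, b, y, hb, hy⟩ := exists_sum_smul_of_smul_eq_zero hE (hfg (f j)) (hann (f j)) hz
  have hsx : s • x = ∑ i, (fun l => (Pi.single i s - Pi.single j (d i) : Fin n → R) l • x i) +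
      ∑ k, (fun l => (Pi.single j (b k) : Fin n → R) l • y k) := by
    ext l
    simp only [Pi.smul_apply, Pi.add_apply, Finset.sum_apply, Pi.sub_apply, sub_smul,
      Finset.sum_sub_distrib, Pi.single_apply, ite_smul, zero_smul]
    rw [Finset.sum_ite_eq Finset.univ l, if_pos (Finset.mem_univ l)]
    by_cases hl : l = j
    · simp [hl, hy]
    · simp [hl]
  rw [hsx]
  refine W.add_mem (W.sum_mem fun i _ => Submodule.subset_span ⟨_, x i, ?_, rfl⟩)
    (W.sum_mem fun k _ => Submodule.subset_span ⟨_, y k, ?_, rfl⟩)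
  · simp only [Pi.sub_apply, Pi.single_apply, mul_sub, mul_ite, mul_zero, Finset.sum_sub_distrib,
      Finset.sum_ite_eq', Finset.mem_univ, if_true]
    linear_combination hd i
  · simp only [Pi.single_apply, mul_ite, mul_zero, Finset.sum_ite_eq', Finset.mem_univ, if_true]
    linear_combination hb k

/-- The double annihilator condition holds as soon as, at each maximal ideal `M`, the elements
of `M` are zero divisors in the localization at `M`. -/
theorem dvd_of_forall_mul_eq_zero (hR : IsLocallyComparable R)
    (hfg : ∀ a : R, ((⊥ : Ideal R).colon {a}).FG)
    (hM : ∀ M : Ideal R, M.IsMaximal → ∀ a ∈ M, ∀ s ∉ M, ∃ x, a * x = 0 ∧ s * x ≠ 0)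
    {a c : R} (hac : ∀ x, x * a = 0 → c * x = 0) : a ∣ c := by
  classical
  by_contra hdvd
  have hne : (Ideal.span {a}).colon {c} ≠ ⊤ := fun h => hdvd (by
    simpa [Submodule.mem_colon_singleton, Ideal.mem_span_singleton] using
      (Ideal.eq_top_iff_one _).1 h)
  obtain ⟨M, hMM, hle⟩ := Ideal.exists_le_maximal _ hne
  have hmem : ∀ t, a ∣ t * c → t ∈ M := fun t ht =>
    hle (Submodule.mem_colon_singleton.2 (Ideal.mem_span_singleton.2 ht))
  obtain ⟨u, v, w, h1, h2⟩ := hR a c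
  have hu : u ∉ M := fun hu => hMM.isPrime.one_sub_notMem hu
    (hmem _ ⟨w, by linear_combination h2⟩)
  have hv : v ∈ M := hmem _ ⟨u, by linear_combination -h1⟩
  -- elements of `cR` killed by `v` vanish locally
  have key : ∀ y, v * (c * y) = 0 → u * (c * y) = 0 := fun y hy => by
    have := hac (u * y) (by linear_combination y * h1 + hy)
    linear_combination this
  obtain ⟨F, hF⟩ := hfg v
  have hFv : ∀ x ∈ F, x * v = 0 := fun x hx => by
    have : x ∈ (⊥ : Ideal R).colon {v} := hF ▸ Submodule.subset_span hx
    simpa [Submodule.mem_colon_singleton] using this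
  have hx : ∀ x ∈ F, ∃ t ∉ M, t * x = 0 := by
    intro x hxF
    obtain ⟨p, q, r, h3, h4⟩ := hR x c
    have hp : p ∉ M := by
      intro hp
      have h5 := key (1 - p) (by linear_combination v * h4 + r * hFv x hxF)
      refine (hMM.isPrime.mem_or_mem (hmem (u * (1 - p)) ?_)).elim hu
        (hMM.isPrime.one_sub_notMem hp)
      exact ⟨0, by linear_combination h5⟩
    refine ⟨u * p, fun h => (hMM.isPrime.mem_or_mem h).elim hu hp, ?_⟩
    have h5 := key q (by linear_combination p * hFv x hxF - v * h3)
    linear_combination h5 + u * h3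
  choose! t ht htx using hx
  obtain ⟨x, hvx, hsx⟩ := hM M hMM v hv (∏ x ∈ F, t x) fun h => by
    obtain ⟨x, hx, hxM⟩ := (hMM.isPrime.prod_mem_iff).1 h
    exact ht x hx hxM
  have hxspan : x ∈ Ideal.span (F : Set R) := by
    rw [hF]
    simpa [Submodule.mem_colon_singleton, mul_comm] using hvx
  have hle' : Ideal.span (F : Set R) ≤ (⊥ : Ideal R).colon {∏ x ∈ F, t x} := by
    refine Ideal.span_le.2 fun y hy => ?_
    rw [SetLike.mem_coe, Submodule.mem_colon_singleton, smul_eq_mul, Submodule.mem_bot,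
      ← Finset.mul_prod_erase F t hy]
    linear_combination (∏ z ∈ F.erase y, t z) * htx y hy
  refine hsx ?_
  have := Submodule.mem_colon_singleton.1 (hle' hxspan)
  rw [Submodule.mem_bot, smul_eq_mul] at this
  linear_combination this

/-- Transfer of the preceding criteria to the ring of quotients of `S`. The primes `P` that occur
are those that are maximal among the primes consisting of zero divisors. -/
theorem isIFRing_fractionRing {S : Type u} [CommRing S] (hS : IsLocallyComparable S)
    (hfg : ∀ a : S, ((⊥ : Ideal S).colon {a}).FG)
    (hP : ∀ P : Ideal S, P.IsPrime → (∀ z ∈ P, z ∉ nonZeroDivisors S) →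
      (∀ z ∉ P, ∃ p ∈ P, ∃ r, p + z * r ∈ nonZeroDivisors S) →
      ∀ a ∈ P, ∀ s ∉ P, ∃ x, a * x = 0 ∧ s * x ≠ 0) :
    IsIFRing (FractionRing S) := by
  let Q := FractionRing S
  let f := algebraMap S Q
  have hf : Function.Injective f := IsFractionRing.injective S Q
  have hunit : ∀ z ∈ nonZeroDivisors S, IsUnit (f z) := fun z hz =>
    IsLocalization.map_units (M := nonZeroDivisors S) Q ⟨z, hz⟩
  have hsurj : ∀ q : Q, ∃ (a : S) (ε : Qˣ), q = f a * ε := by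
    intro q
    obtain ⟨⟨a, z⟩, h⟩ := IsLocalization.surj (nonZeroDivisors S) q
    refine ⟨a, (hunit z z.2).unit⁻¹, ?_⟩
    rw [Units.eq_mul_inv_iff_mul_eq]
    exact h
  have hQ : IsLocallyComparable Q := by
    intro a b
    obtain ⟨a, α, rfl⟩ := hsurj a
    obtain ⟨b, β, rfl⟩ := hsurj b
    obtain ⟨u, v, w, h1, h2⟩ := hS a b
    have h1' := congrArg f h1
    have h2' := congrArg f h2
    simp only [map_mul, map_sub, map_one] at h1' h2'
    refine ⟨f u, f v * α * ↑β⁻¹, f w * β * ↑α⁻¹, ?_, ?_⟩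
    · linear_combination (α : Q) * h1' - (f v * α * f b) * β.inv_mul
    · linear_combination (β : Q) * h2' - (f w * β * f a) * α.inv_mul
  have hfgQ : ∀ a : Q, ((⊥ : Ideal Q).colon {a}).FG := by
    intro a
    obtain ⟨a, α, rfl⟩ := hsurj a
    have : (⊥ : Ideal Q).colon {f a * α} = ((⊥ : Ideal S).colon {a}).map f := by
      apply le_antisymm
      · intro x hx
        obtain ⟨x, ξ, rfl⟩ := hsurj x
        rw [Submodule.mem_colon_singleton, Submodule.mem_bot, smul_eq_mul] at hx
        refine Ideal.mul_mem_right _ _ (Ideal.mem_map_of_mem f ?_)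
        rw [Submodule.mem_colon_singleton, Submodule.mem_bot, smul_eq_mul]
        apply hf
        rw [map_mul, map_zero, ← (ξ * α).mul_left_eq_zero, Units.val_mul]
        linear_combination hx
      · refine Ideal.map_le_iff_le_comap.2 fun x hx => ?_
        rw [Submodule.mem_colon_singleton, Submodule.mem_bot, smul_eq_mul] at hx
        rw [Ideal.mem_comap, Submodule.mem_colon_singleton, Submodule.mem_bot, smul_eq_mul,
          ← mul_assoc, ← map_mul, hx, map_zero, zero_mul]
    rw [this]
    exact (hfg a).map f
  refine isIFRing_of_forall_dvd hQ hfgQ fun a c => dvd_of_forall_mul_eq_zero hQ hfgQ ?_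
  intro M hM a ha s hs
  obtain ⟨a, α, rfl⟩ := hsurj a
  obtain ⟨s, σ, rfl⟩ := hsurj s
  rw [Ideal.mul_unit_mem_iff_mem _ α.isUnit] at ha
  rw [Ideal.mul_unit_mem_iff_mem _ σ.isUnit] at hs
  obtain ⟨x, hax, hsx⟩ := hP (M.comap f) (hM.isPrime.comap f)
    (fun z hz hz' => hM.ne_top (M.eq_top_of_isUnit_mem hz (hunit z hz')))
    (fun z hz => by
      obtain ⟨q, hq⟩ := hM.exists_inv hz
      obtain ⟨m, hm, hmq⟩ := hq
      obtain ⟨⟨r, d⟩, hrd⟩ := IsLocalization.surj (nonZeroDivisors S) q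
      refine ⟨d - z * r, ?_, r, by simp⟩
      have : f (d - z * r) = m * f d := by
        rw [map_sub, map_mul]
        linear_combination (-f d) * hmq + f z * hrd
      rw [Ideal.mem_comap, this]
      exact M.mul_mem_right _ hm) a ha s hs
  refine ⟨f x, ?_, fun h => hsx (hf ?_)⟩
  · rw [mul_right_comm, ← map_mul, hax, map_zero, zero_mul]
  · rw [map_zero, map_mul, ← σ.mul_left_eq_zero]
    linear_combination h

end IF

/-! ### Rings of quotients of `R ⧸ A` -/

section QuotientColon

variable {R : Type u} [CommRing R]

theorem IsCoherentRing.colon_singleton_fg (hR : IsCoherentRing R) {A : Ideal R} (hA : A.FG)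
    (a : R) : (A.colon {a}).FG := by
  let J : Ideal R := A ⊔ Ideal.span {a}
  have hJ : J.FG := Submodule.FG.sup hA ⟨{a}, by simp⟩
  have hAJ : A ≤ J := le_sup_left
  have haJ : a ∈ J := le_sup_right (α := Ideal R) (Ideal.mem_span_singleton_self a)
  have := hR J hJ
  let K : Submodule R J := Submodule.comap (Submodule.subtype J) A
  have hK : K.FG := by
    refine Submodule.fg_of_fg_map_injective J.subtype J.injective_subtype ?_
    rw [Submodule.map_comap_subtype, inf_eq_right.2 hAJ]
    exact hA
  have : Module.FinitePresentation R (J ⧸ K) :=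
    Module.finitePresentation_of_surjective K.mkQ K.mkQ_surjective (by rwa [Submodule.ker_mkQ])
  let g : R →ₗ[R] J ⧸ K := LinearMap.toSpanSingleton R _ (K.mkQ ⟨a, haJ⟩)
  have hg : Function.Surjective g := by
    intro y
    obtain ⟨⟨z, hz⟩, rfl⟩ := K.mkQ_surjective y
    obtain ⟨α, hα, t, ht, rfl⟩ := Submodule.mem_sup.1 hz
    obtain ⟨r, rfl⟩ := Ideal.mem_span_singleton'.1 ht
    refine ⟨r, ?_⟩
    rw [LinearMap.toSpanSingleton_apply, ← map_smul, Submodule.mkQ_apply, Submodule.mkQ_apply,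
      Submodule.Quotient.eq]
    change r * a - (α + r * a) ∈ A
    rw [sub_add_cancel_right]
    exact A.neg_mem hα
  have hker : A.colon {a} = LinearMap.ker g := by
    ext r
    rw [Submodule.mem_colon_singleton, LinearMap.mem_ker, LinearMap.toSpanSingleton_apply,
      ← map_smul, Submodule.mkQ_apply, Submodule.Quotient.mk_eq_zero]
    rfl
  rw [hker]
  exact Module.FinitePresentation.fg_ker g hg

theorem colon_singleton_fg_quotient {A : Ideal R} (hA : ∀ a : R, (A.colon {a}).FG) (a : R ⧸ A) :
    ((⊥ : Ideal (R ⧸ A)).colon {a}).FG := by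
  obtain ⟨a, rfl⟩ := Ideal.Quotient.mk_surjective a
  have : (⊥ : Ideal (R ⧸ A)).colon {Ideal.Quotient.mk A a} =
      (A.colon {a}).map (Ideal.Quotient.mk A) := by
    ext x
    obtain ⟨x, rfl⟩ := Ideal.Quotient.mk_surjective x
    rw [Ideal.mem_quotient_iff_mem fun y hy => Submodule.mem_colon_singleton.2
      (Ideal.mul_mem_right _ _ hy), Submodule.mem_colon_singleton, Submodule.mem_colon_singleton,
      smul_eq_mul, smul_eq_mul, ← map_mul, Submodule.mem_bot, Ideal.Quotient.eq_zero_iff_mem]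
  rw [this]
  exact (hA a).map _

/-- Membership in `nonZeroDivisors (R ⧸ A)`, stated in `R`. -/
def IsRegularModulo (A : Ideal R) (z : R) : Prop :=
  ∀ y, z * y ∈ A → y ∈ A

theorem mk_mem_nonZeroDivisors_iff {A : Ideal R} {z : R} :
    Ideal.Quotient.mk A z ∈ nonZeroDivisors (R ⧸ A) ↔ IsRegularModulo A z := by
  rw [mem_nonZeroDivisors_iff_left, Ideal.Quotient.mk_surjective.forall]
  simp only [← map_mul, Ideal.Quotient.eq_zero_iff_mem, IsRegularModulo]

/-- `isIFRing_fractionRing` for a quotient `R ⧸ A`, stated in `R`. -/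
theorem isIFRing_fractionRing_quotient (hR : IsLocallyComparable R) {A : Ideal R}
    (hfg : ∀ a : R, (A.colon {a}).FG)
    (hP : ∀ P : Ideal R, P.IsPrime → A ≤ P → (∀ z ∈ P, ¬ IsRegularModulo A z) →
      (∀ z ∉ P, ∃ p ∈ P, ∃ r, IsRegularModulo A (p + z * r)) →
      ∀ a ∈ P, ∀ s ∉ P, ∃ x, a * x ∈ A ∧ s * x ∉ A) :
    IsIFRing (FractionRing (R ⧸ A)) := by
  have hmk := Ideal.Quotient.mk_surjective (I := A)
  refine isIFRing_fractionRing (hR.of_surjective _ hmk) (colon_singleton_fg_quotient hfg) ?_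
  intro P hPP hPz hPm a ha s hs
  obtain ⟨a, rfl⟩ := hmk a
  obtain ⟨s, rfl⟩ := hmk s
  obtain ⟨x, hax, hsx⟩ := hP (P.comap (Ideal.Quotient.mk A)) (hPP.comap _)
    (fun y hy => by rw [Ideal.mem_comap, Ideal.Quotient.eq_zero_iff_mem.2 hy]; exact P.zero_mem)
    (fun z hz hz' => hPz _ hz (mk_mem_nonZeroDivisors_iff.2 hz'))
    (fun z hz => by
      obtain ⟨p, hp, r, hpr⟩ := hPm _ hz
      obtain ⟨p, rfl⟩ := hmk p
      obtain ⟨r, rfl⟩ := hmk r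
      rw [← map_mul, ← map_add, mk_mem_nonZeroDivisors_iff] at hpr
      exact ⟨p, hp, r, hpr⟩) a ha s hs
  refine ⟨Ideal.Quotient.mk A x, ?_, ?_⟩
  · rwa [← map_mul, Ideal.Quotient.eq_zero_iff_mem]
  · rwa [← map_mul, Ne, Ideal.Quotient.eq_zero_iff_mem]

/-- If the finitely generated ideal `A` does not vanish at the prime `P ⊇ A`, then the elements of
`P` are zero divisors of `(R ⧸ A)_P`: the localization `A_P` is generated by some `α ≠ 0`, and if
`α = a b` with `a ∈ P`, then `a` kills `b`, which is not in `A_P`. -/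
theorem exists_mul_mem_of_ne_zero_at (hR : IsLocallyComparable R) {A P : Ideal R} (hA : A.FG)
    (hP : P.IsPrime) (hAP : A ≤ P) (hne : ∃ α ∈ A, ∀ t ∉ P, t * α ≠ 0) {a s : R} (ha : a ∈ P)
    (hs : s ∉ P) : ∃ x, a * x ∈ A ∧ s * x ∉ A := by
  by_contra! hcon
  obtain ⟨F, rfl⟩ := hA
  have hF : F.Nonempty := by
    rw [Finset.nonempty_iff_ne_empty]
    rintro rfl
    obtain ⟨α, hα, h⟩ := hne
    rw [Finset.coe_empty, Ideal.span_empty, Submodule.mem_bot] at hα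
    exact h s hs (by rw [hα, mul_zero])
  obtain ⟨j, hj, c, hc, hcd⟩ := hR.exists_dominant hP id hF
  have hdom : ∀ y ∈ Ideal.span (F : Set R), ∃ d, c * y = d * j := by
    have : Ideal.span (F : Set R) ≤ (Ideal.span {j}).colon {c} := Ideal.span_le.2 fun y hy => by
      obtain ⟨d, hd⟩ := hcd y hy
      exact Submodule.mem_colon_singleton.2 (Ideal.mem_span_singleton'.2 ⟨d, by
        rw [smul_eq_mul, mul_comm y]; exact hd.symm⟩)
    intro y hy
    obtain ⟨d, hd⟩ := Ideal.mem_span_singleton'.1 (Submodule.mem_colon_singleton.1 (this hy))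
    exact ⟨d, by rw [hd, smul_eq_mul, mul_comm]⟩
  have hjne : ∀ t ∉ P, t * j ≠ 0 := by
    intro t ht htj
    obtain ⟨α, hα, h⟩ := hne
    obtain ⟨d, hd⟩ := hdom α hα
    refine h (t * c) (fun h => (hP.mem_or_mem h).elim ht hc) ?_
    linear_combination t * hd + d * htj
  have hjA : j ∈ Ideal.span (F : Set R) := Ideal.subset_span hj
  obtain ⟨u, v, w, h1, h2⟩ := hR j a
  have hu : u ∉ P := by
    intro hu
    have h3 : a * (1 - u) ∈ Ideal.span (F : Set R) := by
      rw [mul_comm, h2]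
      exact Ideal.mul_mem_left _ _ hjA
    exact (hP.mem_or_mem (hAP (hcon _ h3))).elim hs (hP.one_sub_notMem hu)
  have h3 : a * v ∈ Ideal.span (F : Set R) := by
    rw [mul_comm, ← h1]
    exact Ideal.mul_mem_left _ _ hjA
  obtain ⟨d, hd⟩ := hdom _ (hcon _ h3)
  refine hjne (c * s * u - d * a) (fun h => ?_) ?_
  · have := P.add_mem h (P.mul_mem_left d ha)
    rw [sub_add_cancel] at this
    exact (hP.mem_or_mem this).elim (fun h => (hP.mem_or_mem h).elim hc hs) hu
  · linear_combination c * s * h1 + a * hd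

end QuotientColon

/-! ### The classes of primes of an arithmetical ring -/

section PSpec

variable {R : Type u} [CommRing R]

theorem IsLocallyComparable.le_total_of_le (hR : IsLocallyComparable R) {P N₁ N₂ : Ideal R}
    (hP : P.IsPrime) (h₁ : N₁.IsPrime) (h₂ : N₂.IsPrime) (hl₁ : N₁ ≤ P) (hl₂ : N₂ ≤ P) :
    N₁ ≤ N₂ ∨ N₂ ≤ N₁ := by
  by_contra! h
  obtain ⟨a, ha, ha'⟩ := Set.not_subset.1 h.1
  obtain ⟨b, hb, hb'⟩ := Set.not_subset.1 h.2
  obtain ⟨u, v, w, h1, h2⟩ := hR a b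
  by_cases hu : u ∈ P
  · have : (1 - u) * b ∈ N₁ := h2 ▸ N₁.mul_mem_left w ha
    exact (h₁.mem_or_mem this).elim (fun h => hP.one_sub_notMem hu (hl₁ h)) hb'
  · have : u * a ∈ N₂ := h1 ▸ N₂.mul_mem_left v hb
    exact (h₂.mem_or_mem this).elim (fun h => hu (hl₂ h)) ha'

/-- In an arithmetical ring every prime contains exactly one minimal prime, so the points of
`PSpec R` are the closed irreducible sets `V(N)` with `N` a minimal prime. -/
theorem IsLocallyComparable.exists_minimalPrime (hR : IsLocallyComparable R) (x : PSpec R) :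
    ∃ N ∈ minimalPrimes R, ∀ P : PrimeSpectrum R, toPSpec R P = x ↔ N ≤ P.asIdeal := by
  obtain ⟨P₀, rfl⟩ := Quot.exists_rep x
  obtain ⟨N, hN, hNP⟩ := Ideal.exists_minimalPrimes_le (I := ⊥) (J := P₀.asIdeal) bot_le
  have hinv : ∀ P Q : PrimeSpectrum R, P ≤ Q → (N ≤ P.asIdeal) = (N ≤ Q.asIdeal) := by
    intro P Q hPQ
    refine propext ⟨fun h => h.trans hPQ, fun h => ?_⟩
    rcases hR.le_total_of_le Q.2 hN.1.1 P.2 h hPQ with h' | h'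
    · exact h'
    · exact hN.2 ⟨P.2, bot_le⟩ h'
  refine ⟨N, hN, fun P => ⟨fun h => ?_, fun h => ?_⟩⟩
  · have := congrArg (Quot.lift (fun P : PrimeSpectrum R => N ≤ P.asIdeal) hinv) h
    exact this.mpr hNP
  · have h1 : toPSpec R ⟨N, hN.1.1⟩ = toPSpec R P := toPSpec_eq_of_le h
    have h2 : toPSpec R ⟨N, hN.1.1⟩ = toPSpec R P₀ := toPSpec_eq_of_le hNP
    exact h1.symm.trans h2

theorem isClosed_singleton_of_forall_iff {N : Ideal R} {x : PSpec R}
    (h : ∀ P : PrimeSpectrum R, toPSpec R P = x ↔ N ≤ P.asIdeal) :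
    IsClosed ({x} : Set (PSpec R)) := by
  refine isQuotientMap_quot_mk.isClosed_preimage.1 ?_
  have : toPSpec R ⁻¹' {x} = PrimeSpectrum.zeroLocus (N : Set R) := Set.ext h
  exact this ▸ PrimeSpectrum.isClosed_zeroLocus _

theorem pureIdealAt_le {N : Ideal R} {x : PSpec R} (hN : N.IsPrime)
    (h : ∀ P : PrimeSpectrum R, toPSpec R P = x ↔ N ≤ P.asIdeal) : pureIdealAt x ≤ N := by
  intro a ha
  obtain ⟨s, hs, hsa⟩ := (mem_pureIdealAt a).1 ha ⟨N, hN⟩ ((h _).2 le_rfl)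
  exact (hN.mem_or_mem (hsa ▸ N.zero_mem : s * a ∈ N)).resolve_left hs

/-- Every member of `B` is a multiple of an idempotent member of `B`. -/
def IsGeneratedByIdempotents (B : Ideal R) : Prop :=
  ∀ b ∈ B, ∃ e ∈ B, IsIdempotentElem e ∧ b * (1 - e) = 0

/-- In an almost clean ring, write `1 - c = e + r` with `c ∈ A(x)`: since `c` vanishes at the
primes of `x` and `r` is regular, `e` vanishes there too. -/
theorem IsAlmostCleanRing.pureIdealAt (hR : IsAlmostCleanRing R) {x : PSpec R}
    (hx : IsClosed ({x} : Set (PSpec R))) : IsGeneratedByIdempotents (pureIdealAt x) := by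
  intro a ha
  have := pureIdealAt_pure hx
  obtain ⟨c, hc, hac⟩ := Ideal.exists_eq_mul_of_pure ha
  obtain ⟨e, r, he, hr, her⟩ := hR (1 - c)
  have he' : e * e = e := he
  refine ⟨e, (mem_pureIdealAt e).2 fun P hP => ?_, he, ?_⟩
  · refine ⟨1 - e, P.2.one_sub_notMem ?_, by linear_combination -he'⟩
    obtain ⟨t, ht, htc⟩ := (mem_pureIdealAt c).1 hc P hP
    by_contra hePi
    have h1 : (t * e) * r = 0 := by
      linear_combination -t * e * her - e * htc - t * he'
    have h2 := (mem_nonZeroDivisors_iff_right.1 hr) _ h1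
    exact (P.2.mem_or_mem (h2 ▸ P.asIdeal.zero_mem : t * e ∈ P.asIdeal)).elim ht hePi
  · refine (mem_nonZeroDivisors_iff_right.1 hr) _ ?_
    linear_combination (1 - e) * hac - a * (1 - e) * her + a * he'

end PSpec

/-! ### Ideals generated by idempotents -/

section AlmostClean

variable {R : Type u} [CommRing R]

theorem mem_sup_of_mul_one_sub_mem {A B : Ideal R} {e z : R} (he : z * (1 - e) ∈ A)
    (heB : e ∈ B) : z ∈ A ⊔ B := by
  have : z = z * (1 - e) + z * e := by ring
  rw [this]
  exact Ideal.add_mem _ (Ideal.mem_sup_left he) (Ideal.mem_sup_right (B.mul_mem_left _ heB))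

theorem IsGeneratedByIdempotents.exists_of_mem_sup {A B : Ideal R}
    (hB : IsGeneratedByIdempotents B) {z : R} (hz : z ∈ A ⊔ B) :
    ∃ e ∈ B, IsIdempotentElem e ∧ z * (1 - e) ∈ A := by
  obtain ⟨α, hα, b, hb, rfl⟩ := Submodule.mem_sup.1 hz
  obtain ⟨e, he, hee, hbe⟩ := hB b hb
  refine ⟨e, he, hee, ?_⟩
  rw [add_mul, hbe, add_zero]
  exact A.mul_mem_right _ hα

theorem IsGeneratedByIdempotents.exists_of_fg_le_sup {A B J : Ideal R}
    (hB : IsGeneratedByIdempotents B) (hJ : J.FG) (hle : J ≤ A ⊔ B) :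
    ∃ e ∈ B, IsIdempotentElem e ∧ ∀ z ∈ J, z * (1 - e) ∈ A := by
  classical
  obtain ⟨F, rfl⟩ := hJ
  suffices ∃ e ∈ B, IsIdempotentElem e ∧ ∀ z ∈ F, z * (1 - e) ∈ A by
    obtain ⟨e, he, hee, h⟩ := this
    refine ⟨e, he, hee, fun z hz => ?_⟩
    have hFA : Ideal.span (F : Set R) ≤ A.colon {1 - e} :=
      Ideal.span_le.2 fun y hy => Submodule.mem_colon_singleton.2 (h y hy)
    exact Submodule.mem_colon_singleton.1 (hFA hz)
  have hF : ∀ z ∈ F, z ∈ A ⊔ B := fun z hz => hle (Ideal.subset_span hz)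
  clear hle
  induction F using Finset.induction_on with
  | empty => exact ⟨0, B.zero_mem, IsIdempotentElem.zero, by simp⟩
  | insert z F hz ih =>
    obtain ⟨e, he, hee, h⟩ := ih fun y hy => hF y (Finset.mem_insert_of_mem hy)
    obtain ⟨f, hf, hff, hz⟩ := hB.exists_of_mem_sup (hF z (Finset.mem_insert_self z F))
    refine ⟨e + f - e * f, B.sub_mem (B.add_mem he hf) (B.mul_mem_right _ he), ?_, ?_⟩
    · have h1 : e * e = e := hee
      have h2 : f * f = f := hff
      change (e + f - e * f) * (e + f - e * f) = e + f - e * f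
      linear_combination (1 - 2 * f + f * f) * h1 + (1 - e) * h2
    · have hfac : 1 - (e + f - e * f) = (1 - e) * (1 - f) := by ring
      intro y hy
      rw [hfac]
      rcases Finset.mem_insert.1 hy with rfl | hy
      · rw [mul_left_comm]
        exact A.mul_mem_left _ hz
      · rw [← mul_assoc]
        exact A.mul_mem_right _ (h y hy)

/-- The zero divisors of `R ⧸ C` are closed under addition. -/
def ZeroDivisorsAddClosedModulo (C : Ideal R) : Prop :=
  ∀ z₁ z₂ : R, ¬ IsRegularModulo C z₁ → ¬ IsRegularModulo C z₂ → ¬ IsRegularModulo C (z₁ + z₂)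

/-- Let `B` be generated by idempotents and let `P ⊇ A + B` be a prime that is maximal among the
primes formed by zero divisors modulo `A`. If the zero divisors modulo `A + B` form an ideal, this
ideal is `P`, and `(R ⧸ A)_P` is the ring of quotients of `R ⧸ (A + B)`. -/
theorem exists_mul_mem_of_zeroDivisorsAddClosedModulo {A B P : Ideal R}
    (hfg : ∀ a : R, (A.colon {a}).FG) (hB : IsGeneratedByIdempotents B)
    (hC : ZeroDivisorsAddClosedModulo (A ⊔ B)) (hBP : B ≤ P)
    (hPz : ∀ z ∈ P, ¬ IsRegularModulo A z)
    (hPm : ∀ z ∉ P, ∃ p ∈ P, ∃ r, IsRegularModulo A (p + z * r)) {a s : R} (ha : a ∈ P)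
    (hs : s ∉ P) : ∃ x, a * x ∈ A ∧ s * x ∉ A := by
  by_contra! hcon
  have hreg : ∀ z, IsRegularModulo A z → IsRegularModulo (A ⊔ B) z := by
    intro z hz y hy
    obtain ⟨e, he, -, h⟩ := hB.exists_of_mem_sup hy
    exact mem_sup_of_mul_one_sub_mem (hz _ (by rwa [← mul_assoc])) he
  have hzero : ∀ p ∈ P, ¬ IsRegularModulo (A ⊔ B) p := by
    intro p hp hpC
    obtain ⟨e, he, hee, h⟩ := hB.exists_of_fg_le_sup (hfg p) fun y hy => hpC y
      (Ideal.mem_sup_left (by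
        have := Submodule.mem_colon_singleton.1 hy
        rwa [smul_eq_mul, mul_comm] at this))
    have hee' : e * e = e := hee
    refine hPz (p * (1 - e) + e) (P.add_mem (P.mul_mem_right _ hp) (hBP he)) fun y hy => ?_
    have h1 : (1 - e) * y ∈ A.colon {p} := by
      refine Submodule.mem_colon_singleton.2 ?_
      have : (1 - e) * y * p = (1 - e) * ((p * (1 - e) + e) * y) := by
        linear_combination (-(p - 1) * y) * hee'
      rw [smul_eq_mul, this]
      exact A.mul_mem_left _ hy
    have h2 : y = (1 - e) * y * (1 - e) + e * ((p * (1 - e) + e) * y) := by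
      linear_combination (p * y - 2 * y) * hee'
    rw [h2]
    exact A.add_mem (h _ h1) (A.mul_mem_left _ hy)
  obtain ⟨p, hp, r, hpr⟩ := hPm s hs
  have hsC : IsRegularModulo (A ⊔ B) s := by
    by_contra hsC
    refine hC p (s * r) (hzero p hp) (fun h => hsC fun y hy => h y ?_) (hreg _ hpr)
    rw [mul_right_comm]
    exact Ideal.mul_mem_right _ _ hy
  refine hzero a ha fun y hy => ?_
  obtain ⟨e, he, -, h⟩ := hB.exists_of_mem_sup hy
  rw [mul_assoc] at h
  have h1 := hsC _ (Ideal.mem_sup_left (hcon _ h))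
  have h2 : y = y * (1 - e) + y * e := by ring
  rw [h2]
  exact Ideal.add_mem _ h1 (Ideal.mem_sup_right (B.mul_mem_left _ he))

end AlmostClean

/-! ### Quotients whose zero divisors form an ideal -/

section ZeroDivisors

variable {R : Type u} [CommRing R]

theorem not_isRegularModulo_iff {C : Ideal R} {z : R} :
    ¬ IsRegularModulo C z ↔ ∃ y ∉ C, z * y ∈ C := by
  simp only [IsRegularModulo, not_forall, exists_prop]
  exact ⟨fun ⟨y, h1, h2⟩ => ⟨y, h2, h1⟩, fun ⟨y, h1, h2⟩ => ⟨y, h2, h1⟩⟩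

theorem Ideal.IsPrime.zeroDivisorsAddClosedModulo {C : Ideal R} (hC : C.IsPrime) :
    ZeroDivisorsAddClosedModulo C := by
  intro z₁ z₂ h₁ h₂
  obtain ⟨y₁, hy₁, hz₁⟩ := not_isRegularModulo_iff.1 h₁
  obtain ⟨y₂, hy₂, hz₂⟩ := not_isRegularModulo_iff.1 h₂
  refine not_isRegularModulo_iff.2 ⟨1, (Ideal.ne_top_iff_one C).1 hC.ne_top, ?_⟩
  rw [mul_one]
  exact C.add_mem ((hC.mem_or_mem hz₁).resolve_right hy₁) ((hC.mem_or_mem hz₂).resolve_right hy₂)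

theorem IsLocallyComparable.zeroDivisorsAddClosedModulo_of_isLocalRing
    (hR : IsLocallyComparable R) {B C : Ideal R} (hB : IsLocalRing (R ⧸ B)) (hBC : B ≤ C) :
    ZeroDivisorsAddClosedModulo C := by
  intro z₁ z₂ h₁ h₂
  obtain ⟨y₁, hy₁, hz₁⟩ := not_isRegularModulo_iff.1 h₁
  obtain ⟨y₂, hy₂, hz₂⟩ := not_isRegularModulo_iff.1 h₂
  -- a unit modulo `B` can be cancelled modulo `C`
  have cancel : ∀ u y : R, IsUnit (Ideal.Quotient.mk B u) → u * y ∈ C → y ∈ C := by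
    intro u y hu huy
    obtain ⟨q, hq⟩ := hu.exists_right_inv
    obtain ⟨q, rfl⟩ := Ideal.Quotient.mk_surjective q
    rw [← map_mul, ← map_one (Ideal.Quotient.mk B), Ideal.Quotient.eq] at hq
    have h1 := C.sub_mem (C.mul_mem_left q huy) (C.mul_mem_right y (hBC hq))
    have h2 : q * (u * y) - (u * q - 1) * y = y := by ring
    rwa [h2] at h1
  obtain ⟨u, v, w, h3, h4⟩ := hR y₁ y₂
  rw [not_isRegularModulo_iff]
  rcases IsLocalRing.isUnit_or_isUnit_one_sub_self (Ideal.Quotient.mk B u) with hu | hu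
  · refine ⟨u * y₁, fun h => hy₁ (cancel _ _ hu h), ?_⟩
    have : (z₁ + z₂) * (u * y₁) = u * (z₁ * y₁) + v * (z₂ * y₂) := by
      linear_combination z₂ * h3
    rw [this]
    exact C.add_mem (C.mul_mem_left _ hz₁) (C.mul_mem_left _ hz₂)
  · rw [← map_one (Ideal.Quotient.mk B), ← map_sub] at hu
    refine ⟨(1 - u) * y₂, fun h => hy₂ (cancel _ _ hu h), ?_⟩
    have : (z₁ + z₂) * ((1 - u) * y₂) = w * (z₁ * y₁) + (1 - u) * (z₂ * y₂) := by
      linear_combination z₁ * h4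
    rw [this]
    exact C.add_mem (C.mul_mem_left _ hz₁) (C.mul_mem_left _ hz₂)

/-- Let `N ⊇ C` be a prime that is nil and uniserial modulo `C`. If `N ≠ C`, then every zero
divisor modulo `C` kills an element of `N \ C` modulo `C`, and any two of these are comparable. -/
theorem zeroDivisorsAddClosedModulo_of_uniserial {C N : Ideal R} (hN : N.IsPrime) (hCN : C ≤ N)
    (hnil : ∀ n ∈ N, ∃ k, n ^ k ∈ C)
    (huni : ∀ m ∈ N, ∀ n ∈ N, (∃ q, m - q * n ∈ C) ∨ ∃ q, n - q * m ∈ C) :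
    ZeroDivisorsAddClosedModulo C := by
  classical
  by_cases hNC : N ≤ C
  · exact (le_antisymm hCN hNC ▸ hN : C.IsPrime).zeroDivisorsAddClosedModulo
  obtain ⟨n₀, hn₀, hn₀C⟩ := Set.not_subset.1 hNC
  have h1C : (1 : R) ∉ C := fun h => hn₀C (by simpa using C.mul_mem_left n₀ h)
  have key : ∀ z, ¬ IsRegularModulo C z → ∃ n ∈ N, n ∉ C ∧ z * n ∈ C := by
    intro z hz
    obtain ⟨y, hyC, hzy⟩ := not_isRegularModulo_iff.1 hz
    by_cases hzN : z ∈ N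
    · have hex := hnil z hzN
      obtain ⟨k, hk⟩ : ∃ k, Nat.find hex = k + 1 := Nat.exists_eq_succ_of_ne_zero fun h0 => by
        have := Nat.find_spec hex
        rw [h0, pow_zero] at this
        exact h1C this
      have hk1 : z ^ (k + 1) ∈ C := hk ▸ Nat.find_spec hex
      have hk0 : z ^ k ∉ C := Nat.find_min hex (by omega)
      rcases Nat.eq_zero_or_pos k with rfl | hkpos
      · exact ⟨n₀, hn₀, hn₀C, C.mul_mem_right _ (by simpa using hk1)⟩
      · exact ⟨z ^ k, N.pow_mem_of_mem hzN k hkpos, hk0, by rwa [← pow_succ']⟩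
    · exact ⟨y, (hN.mem_or_mem (hCN hzy)).resolve_left hzN, hyC, hzy⟩
  -- if `m` is a multiple of `n` modulo `C`, then `m` is killed by whatever kills `n`
  have kill : ∀ z m n q, z * n ∈ C → m - q * n ∈ C → z * m ∈ C := by
    intro z m n q hz hm
    have : z * m = q * (z * n) + z * (m - q * n) := by ring
    rw [this]
    exact C.add_mem (C.mul_mem_left _ hz) (C.mul_mem_left _ hm)
  intro z₁ z₂ h₁ h₂
  obtain ⟨m, hmN, hmC, hm⟩ := key _ h₁
  obtain ⟨n, hnN, hnC, hn⟩ := key _ h₂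
  rw [not_isRegularModulo_iff]
  rcases huni m hmN n hnN with ⟨q, hq⟩ | ⟨q, hq⟩
  · exact ⟨m, hmC, by rw [add_mul]; exact C.add_mem hm (kill _ _ _ _ hn hq)⟩
  · exact ⟨n, hnC, by rw [add_mul]; exact C.add_mem (kill _ _ _ _ hm hq) hn⟩

theorem zeroDivisorsAddClosedModulo_of_isTorchRing {A B N : Ideal R} (hN : N ∈ minimalPrimes R)
    (hBN : B ≤ N) (hAN : A ≤ N) (hB : IsTorchRing (R ⧸ B)) :
    ZeroDivisorsAddClosedModulo (A ⊔ B) := by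
  obtain ⟨-, -, N', hN', -, huni⟩ := hB
  have hN'm : N' ∈ minimalPrimes (R ⧸ B) := hN' ▸ rfl
  have hcomap : N ≤ N'.comap (Ideal.Quotient.mk B) := by
    have hprime : (N.map (Ideal.Quotient.mk B)).IsPrime :=
      haveI := hN.1.1
      Ideal.map_isPrime_of_surjective Ideal.Quotient.mk_surjective (by rwa [Ideal.mk_ker])
    obtain ⟨Q, hQ, hQN⟩ := Ideal.exists_minimalPrimes_le (I := ⊥)
      (J := N.map (Ideal.Quotient.mk B)) bot_le
    have hQ' : Q = N' := by
      have : Q ∈ ({N'} : Set (Ideal (R ⧸ B))) := hN' ▸ hQ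
      exact this
    subst hQ'
    refine hN.2 ⟨hN'm.1.1.comap _, bot_le⟩ fun x hx => ?_
    exact (Ideal.mem_quotient_iff_mem hBN).1 (hQN hx)
  refine zeroDivisorsAddClosedModulo_of_uniserial hN.1.1 (sup_le hAN hBN) ?_ ?_
  · intro n hn
    have h1 : Ideal.Quotient.mk B n ∈ nilradical (R ⧸ B) := by
      rw [nilradical, ← Ideal.sInf_minimalPrimes]
      change _ ∈ sInf (minimalPrimes (R ⧸ B))
      rw [hN', sInf_singleton]
      exact hcomap hn
    obtain ⟨k, hk⟩ := mem_nilradical.1 h1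
    rw [← map_pow, Ideal.Quotient.eq_zero_iff_mem] at hk
    exact ⟨k, Ideal.mem_sup_right hk⟩
  · have hmul : ∀ m (hm : m ∈ N) n (hn : n ∈ N),
        Submodule.span (R ⧸ B) {(⟨Ideal.Quotient.mk B m, hcomap hm⟩ : N')} ≤
          Submodule.span (R ⧸ B) {(⟨Ideal.Quotient.mk B n, hcomap hn⟩ : N')} →
        ∃ q, m - q * n ∈ A ⊔ B := by
      intro m hm n hn hmn
      obtain ⟨q, hq⟩ := Submodule.mem_span_singleton.1
        (hmn (Submodule.mem_span_singleton_self _))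
      obtain ⟨q, rfl⟩ := Ideal.Quotient.mk_surjective q
      have hq' : Ideal.Quotient.mk B q * Ideal.Quotient.mk B n = Ideal.Quotient.mk B m :=
        congrArg Subtype.val hq
      rw [← map_mul, eq_comm, Ideal.Quotient.eq] at hq'
      exact ⟨q, Ideal.mem_sup_right hq'⟩
    intro m hm n hn
    exact (huni _ _).imp (hmul m hm n hn) (hmul n hn m hm)

end ZeroDivisors

/-! ### Almost clean and clean rings -/

section Sufficient

variable {R : Type u} [CommRing R]

/-- A finitely generated ideal `A` either does not vanish at a given prime `P ⊇ A`, or is contained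
in the minimal prime of the class of `P`; the two cases are treated separately. -/
theorem isFinitelyFractionallyIF_of_isAlmostCleanRing (hac : IsAlmostCleanRing R)
    (hcoh : IsCoherentRing R) (hR : IsLocallyComparable R)
    (hx : ∀ x : PSpec R, IsTorchRing (R ⧸ pureIdealAt x) ∨ IsLocalRing (R ⧸ pureIdealAt x) ∨
      IsDomain (R ⧸ pureIdealAt x)) : IsFinitelyFractionallyIF R := by
  intro A hA
  have hfg := hcoh.colon_singleton_fg hA
  refine isIFRing_fractionRing_quotient hR hfg ?_
  intro P hP hAP hPz hPm a ha s hs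
  by_cases hne : ∃ α ∈ A, ∀ t ∉ P, t * α ≠ 0
  · exact exists_mul_mem_of_ne_zero_at hR hA hP hAP hne ha hs
  push Not at hne
  obtain ⟨N, hN, hNx⟩ := hR.exists_minimalPrime (toPSpec R ⟨P, hP⟩)
  have hNP : N ≤ P := (hNx ⟨P, hP⟩).1 rfl
  have hAN : A ≤ N := fun α hα => by
    obtain ⟨t, ht, htα⟩ := hne α hα
    exact (hN.1.1.mem_or_mem (htα ▸ N.zero_mem : t * α ∈ N)).resolve_left fun h => ht (hNP h)
  have hBN := pureIdealAt_le hN.1.1 hNx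
  have hB := hac.pureIdealAt (isClosed_singleton_of_forall_iff hNx)
  refine exists_mul_mem_of_zeroDivisorsAddClosedModulo hfg hB ?_ (hBN.trans hNP) hPz hPm ha hs
  rcases hx (toPSpec R ⟨P, hP⟩) with ht | hl | hd
  · exact zeroDivisorsAddClosedModulo_of_isTorchRing hN hBN hAN ht
  · exact hR.zeroDivisorsAddClosedModulo_of_isLocalRing hl le_sup_right
  · have hBp := (Ideal.Quotient.isDomain_iff_prime _).1 hd
    rw [sup_eq_right.2 (hAN.trans (hN.2 ⟨hBp, bot_le⟩ hBN))]
    exact hBp.zeroDivisorsAddClosedModulo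

theorem IsCleanRing.isAlmostCleanRing (h : IsCleanRing R) : IsAlmostCleanRing R := fun a => by
  obtain ⟨e, s, he, hs, h⟩ := h a
  exact ⟨e, s, he, hs.mem_nonZeroDivisors, h⟩

/-- If `a = e + s` with `e` idempotent and `s` a unit, then `e` or `1 - e` lies in the minimal prime
of the class `x`, hence vanishes at every prime of `x`; so `a` or `1 - a` is a unit modulo
`A(x)`. -/
theorem IsCleanRing.isLocalRing_quotient (h : IsCleanRing R) (hR : IsLocallyComparable R)
    (x : PSpec R) : IsLocalRing (R ⧸ pureIdealAt x) := by
  obtain ⟨N, hN, hNx⟩ := hR.exists_minimalPrime x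
  have hBN := pureIdealAt_le hN.1.1 hNx
  have hB := h.isAlmostCleanRing.pureIdealAt (isClosed_singleton_of_forall_iff hNx)
  have : Nontrivial (R ⧸ pureIdealAt x) :=
    Ideal.Quotient.nontrivial_iff.2 fun h => hN.1.1.ne_top (top_le_iff.1 (h ▸ hBN))
  have hidem : ∀ e : R, IsIdempotentElem e → e ∈ N → e ∈ pureIdealAt x := by
    intro e he heN
    refine (mem_pureIdealAt e).2 fun P hP => ⟨1 - e, P.2.one_sub_notMem ((hNx P).1 hP heN), ?_⟩
    rw [sub_mul, one_mul, he.eq, sub_self]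
  refine IsLocalRing.of_isUnit_or_isUnit_one_sub_self fun a => ?_
  obtain ⟨a, rfl⟩ := Ideal.Quotient.mk_surjective a
  obtain ⟨e, s, he, hs, rfl⟩ := h a
  have hs' := hs.map (Ideal.Quotient.mk (pureIdealAt x))
  rcases hN.1.1.mem_or_mem (show e * (1 - e) ∈ N by
    rw [mul_sub, mul_one, he.eq, sub_self]; exact N.zero_mem) with heN | heN
  · left
    rwa [map_add, Ideal.Quotient.eq_zero_iff_mem.2 (hidem e he heN), zero_add]
  · right
    have h1 : Ideal.Quotient.mk (pureIdealAt x) (1 - e) = 0 :=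
      Ideal.Quotient.eq_zero_iff_mem.2 (hidem _ he.one_sub heN)
    rw [map_sub, map_one] at h1
    rw [map_add, ← sub_sub, h1, zero_sub]
    exact hs'.neg

theorem IsCleanRing.isFinitelyFractionallyIF (h : IsCleanRing R) (hcoh : IsCoherentRing R)
    (hR : IsLocallyComparable R) : IsFinitelyFractionallyIF R :=
  isFinitelyFractionallyIF_of_isAlmostCleanRing h.isAlmostCleanRing hcoh hR fun x =>
    Or.inr (Or.inl (h.isLocalRing_quotient hR x))

end Sufficient

/-! ### Semihereditary rings -/

section Semihereditary

variable {R : Type u} [CommRing R]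

theorem IsSemihereditaryRing.isCoherentRing (h : IsSemihereditaryRing R) : IsCoherentRing R := by
  intro I hI
  have := h I hI
  have : Module.Finite R I := Module.Finite.iff_fg.2 hI
  exact Module.finitePresentation_of_projective R I

/-- A dual basis `φ₁, φ₂` of the projective ideal `(a, b)` provides the partition of unity: take
`s = 1 - φ₁ a`. -/
theorem IsSemihereditaryRing.isLocallyComparable (h : IsSemihereditaryRing R) :
    IsLocallyComparable R := by
  classical
  intro a b
  let I : Ideal R := Ideal.span {a, b}
  have ha : a ∈ I := Ideal.subset_span (by simp)
  have hb : b ∈ I := Ideal.subset_span (by simp)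
  have := h I ⟨{a, b}, by simp [I]⟩
  let g : R × R →ₗ[R] I := (LinearMap.toSpanSingleton R I ⟨a, ha⟩).coprod
    (LinearMap.toSpanSingleton R I ⟨b, hb⟩)
  have hg : Function.Surjective g := by
    rintro ⟨z, hz⟩
    obtain ⟨p, q, hpq⟩ := Ideal.mem_span_pair.1 hz
    exact ⟨(p, q), Subtype.ext (by simpa [g] using hpq)⟩
  obtain ⟨φ, hφ⟩ := Module.projective_lifting_property g LinearMap.id hg
  have hφ' : ∀ z : I, (φ z).1 * a + (φ z).2 * b = z := fun z => by
    simpa [g] using congrArg Subtype.val (LinearMap.congr_fun hφ z)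
  have hswap : a • φ ⟨b, hb⟩ = b • φ ⟨a, ha⟩ := by
    rw [← map_smul, ← map_smul]
    exact congrArg φ (Subtype.ext (mul_comm a b))
  have h1 := congrArg Prod.fst hswap
  simp only [Prod.smul_fst, smul_eq_mul] at h1
  have h2 := hφ' ⟨a, ha⟩
  dsimp only at h2
  refine ⟨1 - (φ ⟨a, ha⟩).1, (φ ⟨a, ha⟩).2, (φ ⟨b, hb⟩).1, ?_, ?_⟩
  · linear_combination -h2
  · linear_combination -h1

/-- Principal ideals of a semihereditary ring are projective, so annihilators of elements are
generated by idempotents. -/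
theorem IsSemihereditaryRing.exists_annihilator_eq (h : IsSemihereditaryRing R) (a : R) :
    ∃ e, IsIdempotentElem e ∧ e * a = 0 ∧ ∀ t, t * a = 0 → t * e = t := by
  let I : Ideal R := Ideal.span {a}
  have ha : a ∈ I := Ideal.mem_span_singleton_self a
  have := h I ⟨{a}, by simp [I]⟩
  let g : R →ₗ[R] I := LinearMap.toSpanSingleton R I ⟨a, ha⟩
  have hg : Function.Surjective g := by
    rintro ⟨z, hz⟩
    obtain ⟨p, hp⟩ := Ideal.mem_span_singleton'.1 hz
    exact ⟨p, Subtype.ext (by simpa [g] using hp)⟩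
  obtain ⟨φ, hφ⟩ := Module.projective_lifting_property g LinearMap.id hg
  have hφa : φ ⟨a, ha⟩ * a = a := by
    simpa [g] using congrArg Subtype.val (LinearMap.congr_fun hφ ⟨a, ha⟩)
  have hkill : ∀ t, t * a = 0 → t * (1 - φ ⟨a, ha⟩) = t := by
    intro t ht
    have h1 : t • φ ⟨a, ha⟩ = 0 := by
      rw [← map_smul, show t • (⟨a, ha⟩ : I) = 0 from Subtype.ext ht, map_zero]
    rw [smul_eq_mul] at h1
    linear_combination -h1
  have hea : (1 - φ ⟨a, ha⟩) * a = 0 := by linear_combination -hφa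
  exact ⟨1 - φ ⟨a, ha⟩, hkill _ hea, hea, hkill⟩

theorem sub_mem_nonZeroDivisors_of_annihilator {a e : R} (he : IsIdempotentElem e)
    (hea : e * a = 0) (hkill : ∀ t, t * a = 0 → t * e = t) : a - e ∈ nonZeroDivisors R := by
  refine mem_nonZeroDivisors_iff_right.2 fun t ht => ?_
  have he' : e * e = e := he
  have h1 : t * e = 0 := by linear_combination -e * ht + t * hea - t * he'
  rw [← hkill t (by linear_combination ht + h1), h1]

theorem IsSemihereditaryRing.isAlmostCleanRing (h : IsSemihereditaryRing R) :
    IsAlmostCleanRing R := by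
  intro a
  obtain ⟨e, he, hea, hkill⟩ := h.exists_annihilator_eq a
  exact ⟨e, a - e, he, sub_mem_nonZeroDivisors_of_annihilator he hea hkill, by ring⟩

/-- Over a semihereditary ring, `A(x)` is the minimal prime `N` of the class `x`: if the
idempotent `e` generates the annihilator of `n ∈ N`, then `n - e` is regular, so it is not in `N`,
and `e` is a unit at every prime of `x`. -/
theorem IsSemihereditaryRing.isDomain_quotient (h : IsSemihereditaryRing R) (x : PSpec R) :
    IsDomain (R ⧸ pureIdealAt x) := by
  obtain ⟨N, hN, hNx⟩ := h.isLocallyComparable.exists_minimalPrime x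
  have hNp := hN.1.1
  suffices hle : N ≤ pureIdealAt x by
    rw [le_antisymm (pureIdealAt_le hNp hNx) hle]
    exact (Ideal.Quotient.isDomain_iff_prime N).2 hNp
  intro n hn
  obtain ⟨e, he, hen, hkill⟩ := h.exists_annihilator_eq n
  have heN : e ∉ N := fun heN =>
    Set.disjoint_left.1 (Ideal.disjoint_nonZeroDivisors_of_mem_minimalPrimes hN)
      (N.sub_mem hn heN) (sub_mem_nonZeroDivisors_of_annihilator he hen hkill)
  have heN' : 1 - e ∈ N := (hNp.mem_or_mem (show e * (1 - e) ∈ N by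
    rw [mul_sub, mul_one, he.eq, sub_self]; exact N.zero_mem)).resolve_left heN
  refine (mem_pureIdealAt n).2 fun P hP => ⟨e, ?_, hen⟩
  simpa using P.2.one_sub_notMem ((hNx P).1 hP heN')

theorem IsSemihereditaryRing.isFinitelyFractionallyIF (h : IsSemihereditaryRing R) :
    IsFinitelyFractionallyIF R :=
  isFinitelyFractionallyIF_of_isAlmostCleanRing h.isAlmostCleanRing h.isCoherentRing
    h.isLocallyComparable fun x => Or.inr (Or.inr (h.isDomain_quotient x))

end Semihereditary

/-! ### Consequences of the IF property -/

section IFConsequences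

variable {R : Type u} [CommRing R]

/-- Every finitely generated submodule of a finite free module is the kernel of a linear map to a
finite free module; in other words, every finitely presented module embeds in a finite free
module. -/
def HasAnnihilatorCondition (R : Type u) [CommRing R] : Prop :=
  ∀ (m n : ℕ) (M : Fin m → Fin n → R), ∃ (k : ℕ) (G : Fin k → Fin n → R), ∀ v : Fin n → R,
    (∀ i, ∑ j, G i j * v j = 0) ↔ ∃ c : Fin m → R, v = ∑ i, c i • M i

/-- The finitely presented module embeds in an injective module, which is flat, so the embedding
factors through a finite free module. -/
theorem IsIFRing.hasAnnihilatorCondition (hR : IsIFRing R) : HasAnnihilatorCondition R := by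
  classical
  intro m n M
  let K : Submodule R (Fin n → R) := Submodule.span R (Set.range M)
  have : Module.FinitePresentation R ((Fin n → R) ⧸ K) :=
    Module.finitePresentation_of_surjective K.mkQ K.mkQ_surjective
      (by rw [Submodule.ker_mkQ]; exact Submodule.fg_span (Set.finite_range M))
  obtain ⟨E, hE, ι, hι⟩ := CategoryTheory.EnoughInjectives.presentation
    (ModuleCat.of R ((Fin n → R) ⧸ K))
  have hEi : Module.Injective R E := (Module.injective_iff_injective_object R E).2 hE
  have hEf : Module.Flat R E := hR E hEi
  have hιinj : Function.Injective ι.hom := (ModuleCat.mono_iff_injective ι).1 hι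
  obtain ⟨k, g, y, hgy⟩ := Module.Flat.exists_factorization_of_finitePresentation ι.hom
  have hginj : Function.Injective g := by
    have : Function.Injective (y ∘ₗ g) := hgy ▸ hιinj
    exact Function.Injective.of_comp (f := y) this
  refine ⟨k, fun i j => g (K.mkQ (Pi.single j 1)) i, fun v => ?_⟩
  have hgv : ∀ i, g (K.mkQ v) i = ∑ j, g (K.mkQ (Pi.single j 1)) i * v j := by
    intro i
    conv_lhs => rw [pi_eq_sum_univ' v]
    simp only [map_sum, map_smul, Finsupp.finsetSum_apply, Finsupp.smul_apply, smul_eq_mul]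
    refine Finset.sum_congr rfl fun j _ => ?_
    rw [mul_comm]
  have hvK : (∀ i, ∑ j, g (K.mkQ (Pi.single j 1)) i * v j = 0) ↔ v ∈ K := by
    simp only [← hgv]
    rw [← Submodule.Quotient.mk_eq_zero, ← Submodule.mkQ_apply, ← map_eq_zero_iff g hginj,
      Finsupp.ext_iff]
    rfl
  rw [hvK, Submodule.mem_span_range_iff_exists_fun]
  simp only [eq_comm]

theorem HasAnnihilatorCondition.of_ringEquiv {S : Type u} [CommRing S]
    (hR : HasAnnihilatorCondition R) (f : R ≃+* S) : HasAnnihilatorCondition S := by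
  intro m n M
  obtain ⟨k, G, hG⟩ := hR _ _ fun i j => f.symm (M i j)
  refine ⟨k, fun i j => f (G i j), fun v => ?_⟩
  have h := hG fun j => f.symm (v j)
  have h1 : (∀ i, ∑ j, f (G i j) * v j = 0) ↔ ∀ i, ∑ j, G i j * f.symm (v j) = 0 := by
    refine forall_congr' fun i => ?_
    rw [← map_eq_zero_iff f.symm f.symm.injective, map_sum]
    simp
  rw [h1, h]
  constructor
  · rintro ⟨c, hc⟩
    refine ⟨fun i => f (c i), funext fun j => ?_⟩
    have := congrArg f (congrFun hc j)
    simpa using this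
  · rintro ⟨c, rfl⟩
    refine ⟨fun i => f.symm (c i), funext fun j => ?_⟩
    simp

/-- The relations of a finite family form a finitely generated module: if `B` has kernel `R r`,
then they are generated by the rows of `B`, because the row space of `B` is itself a kernel. -/
theorem HasAnnihilatorCondition.exists_generators (hR : HasAnnihilatorCondition R) {n : ℕ}
    (r : Fin n → R) : ∃ (k : ℕ) (B : Fin k → Fin n → R), ∀ t : Fin n → R,
      ∑ j, t j * r j = 0 ↔ ∃ c : Fin k → R, t = ∑ i, c i • B i := by
  obtain ⟨k, B, hB⟩ := hR 1 _ fun _ => r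
  obtain ⟨l, G, hG⟩ := hR _ _ B
  refine ⟨k, B, fun t => ⟨fun ht => (hG t).1 fun i => ?_, ?_⟩⟩
  · have h1 : ∀ i', ∑ j, B i' j * G i j = 0 := by
      intro i'
      have := (hG (B i')).2 ⟨Pi.single i' 1, by simp [Pi.single_apply, ite_smul]⟩ i
      simpa [mul_comm] using this
    obtain ⟨c, hc⟩ := (hB (G i)).1 h1
    rw [hc]
    simp only [Finset.univ_unique, Finset.sum_singleton, Pi.smul_apply, smul_eq_mul]
    have : ∀ j, c default * r j * t j = c default * (t j * r j) := fun j => by ring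
    rw [Finset.sum_congr rfl fun j _ => this j, ← Finset.mul_sum, ht, mul_zero]
  · rintro ⟨c, rfl⟩
    have h1 : ∀ i, ∑ j, B i j * r j = 0 := (hB r).2 ⟨fun _ => 1, by simp⟩
    simp only [Finset.sum_apply, Pi.smul_apply, smul_eq_mul, Finset.sum_mul]
    rw [Finset.sum_comm]
    refine Finset.sum_eq_zero fun i _ => ?_
    simp only [mul_assoc]
    rw [← Finset.mul_sum, h1, mul_zero]

theorem HasAnnihilatorCondition.isCoherentRing (hR : HasAnnihilatorCondition R) :
    IsCoherentRing R := by
  intro I hI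
  obtain ⟨n, r, rfl⟩ := Submodule.fg_iff_exists_fin_generating_family.1 hI
  let g : (Fin n → R) →ₗ[R] Submodule.span R (Set.range r) :=
    (Fintype.linearCombination R r).codRestrict _ fun t => by
      rw [Submodule.mem_span_range_iff_exists_fun]
      exact ⟨t, rfl⟩
  have hg : Function.Surjective g := by
    rintro ⟨z, hz⟩
    obtain ⟨t, ht⟩ := (Submodule.mem_span_range_iff_exists_fun R).1 hz
    exact ⟨t, Subtype.ext ht⟩
  refine Module.finitePresentation_of_surjective g hg ?_
  obtain ⟨k, B, hB⟩ := hR.exists_generators r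
  have : LinearMap.ker g = Submodule.span R (Set.range B) := by
    ext t
    rw [Submodule.mem_span_range_iff_exists_fun, LinearMap.mem_ker, ← Subtype.val_inj]
    refine (hB t).trans ?_
    simp only [eq_comm]
  rw [this]
  exact Submodule.fg_span (Set.finite_range B)

theorem HasAnnihilatorCondition.span_inf_span_fg (hR : HasAnnihilatorCondition R) (a b : R) :
    (Ideal.span {a} ⊓ Ideal.span {b}).FG := by
  obtain ⟨k, B, hB⟩ := hR.exists_generators ![a, b]
  have hB0 : ∀ i, B i 0 * a + B i 1 * b = 0 := fun i => by
    have := (hB (B i)).2 ⟨Pi.single i 1, by simp [Pi.single_apply, ite_smul]⟩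
    simpa using this
  have : Ideal.span {a} ⊓ Ideal.span {b} = Ideal.span (Set.range fun i => B i 0 * a) := by
    apply le_antisymm
    · rintro z ⟨hza, hzb⟩
      obtain ⟨p, rfl⟩ := Ideal.mem_span_singleton'.1 hza
      obtain ⟨q, hq⟩ := Ideal.mem_span_singleton'.1 hzb
      obtain ⟨c, hc⟩ := (hB ![p, -q]).1 (by simp [hq])
      have h0 : p = ∑ i, c i * B i 0 := by simpa using congrFun hc 0
      rw [h0, Finset.sum_mul]
      refine Ideal.sum_mem _ fun i _ => ?_
      rw [mul_assoc]
      exact Ideal.mul_mem_left _ _ (Ideal.subset_span ⟨i, rfl⟩)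
    · rw [Ideal.span_le]
      rintro _ ⟨i, rfl⟩
      refine ⟨Ideal.mem_span_singleton'.2 ⟨_, rfl⟩, Ideal.mem_span_singleton'.2 ⟨-B i 1, ?_⟩⟩
      linear_combination -(hB0 i)
  rw [this]
  exact Submodule.fg_span (Set.finite_range _)

/-- If `aR ∩ bR = 0`, the map `a ↦ a`, `b ↦ 0` on `aR + bR` is multiplication by some `c`. -/
theorem HasAnnihilatorCondition.exists_mul_eq (hR : HasAnnihilatorCondition R) {a b : R}
    (hab : Ideal.span {a} ⊓ Ideal.span {b} = ⊥) : ∃ c, c * a = a ∧ c * b = 0 := by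
  obtain ⟨k, G, hG⟩ := hR 1 _ fun _ => ![a, b]
  have h1 : ∀ i, G i 0 * a + G i 1 * b = 0 := fun i => by
    simpa using (hG ![a, b]).2 ⟨fun _ => 1, by simp⟩ i
  obtain ⟨c, hc⟩ := (hG ![a, 0]).1 fun i => by
    have : G i 0 * a ∈ Ideal.span {a} ⊓ Ideal.span {b} :=
      ⟨Ideal.mem_span_singleton'.2 ⟨_, rfl⟩, Ideal.mem_span_singleton'.2
        ⟨-G i 1, by linear_combination -(h1 i)⟩⟩
    rw [hab, Submodule.mem_bot] at this
    simpa using this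
  refine ⟨c default, ?_, ?_⟩
  · simpa using (congrFun hc 0).symm
  · simpa using (congrFun hc 1).symm

end IFConsequences

/-! ### Rings of dimension zero -/

section DimensionZero

variable {R : Type u} [CommRing R]

/-- A ring in which every prime is maximal is strongly `π`-regular. -/
theorem exists_pow_mul_one_sub_mul_eq_zero (h : ∀ P : Ideal R, P.IsPrime → P.IsMaximal) (a : R) :
    ∃ (n : ℕ) (r : R), a ^ n * (1 - a * r) = 0 := by
  let S : Submonoid R :=
    { carrier := {z | ∃ (n : ℕ) (r : R), z = a ^ n * (1 - a * r)}
      one_mem' := ⟨0, 0, by simp⟩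
      mul_mem' := by
        rintro _ _ ⟨n, r, rfl⟩ ⟨m, q, rfl⟩
        exact ⟨n + m, r + q - a * r * q, by ring⟩ }
  by_contra! hne
  have hdisj : Disjoint ((⊥ : Ideal R) : Set R) (S : Set R) := by
    rw [Set.disjoint_left]
    rintro z hz ⟨n, r, rfl⟩
    exact hne n r hz
  obtain ⟨P, hP, -, hPS⟩ := Ideal.exists_le_prime_disjoint _ S hdisj
  have ha : a ∉ P := fun ha => Set.disjoint_left.1 hPS ha ⟨1, 0, by simp⟩
  obtain ⟨r, i, hi, hri⟩ := (h P hP).exists_inv ha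
  refine Set.disjoint_left.1 hPS hi ⟨0, r, ?_⟩
  linear_combination hri

theorem isUnit_of_mem_nonZeroDivisors_of_forall_isMaximal
    (h : ∀ P : Ideal R, P.IsPrime → P.IsMaximal) {a : R} (ha : a ∈ nonZeroDivisors R) :
    IsUnit a := by
  obtain ⟨n, r, hr⟩ := exists_pow_mul_one_sub_mul_eq_zero h a
  have := mem_nonZeroDivisors_iff_left.1 (pow_mem ha n) _ hr
  exact IsUnit.of_mul_eq_one r (by linear_combination -this)

/-- If `a ^ n = a ^ (n + 1) r`, then `e = (a r) ^ n` is idempotent, and `a - (1 - e)` is a unit: `e`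
is `1` at the primes that do not contain `a` and `0` at the others. -/
theorem isCleanRing_of_forall_isMaximal (h : ∀ P : Ideal R, P.IsPrime → P.IsMaximal) :
    IsCleanRing R := by
  intro a
  obtain ⟨n, r, hr⟩ := exists_pow_mul_one_sub_mul_eq_zero h a
  have hk : ∀ k, a ^ n * (a * r) ^ k = a ^ n := fun k => by
    induction k with
    | zero => simp
    | succ k ih =>
      rw [pow_succ, ← mul_assoc, ih]
      linear_combination -hr
  have he : IsIdempotentElem ((a * r) ^ n) := by
    change (a * r) ^ n * (a * r) ^ n = (a * r) ^ n
    linear_combination r ^ n * hk n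
  have hae : a ^ n * (1 - (a * r) ^ n) = 0 := by rw [mul_sub, hk, mul_one, sub_self]
  refine ⟨1 - (a * r) ^ n, a - (1 - (a * r) ^ n), he.one_sub, ?_, by ring⟩
  by_contra hu
  obtain ⟨P, hP, haP⟩ := exists_max_ideal_of_mem_nonunits hu
  have hPp := hP.isPrime
  have haP' : a - (1 - (a * r) ^ n) ∈ P := haP
  rcases hPp.mem_or_mem (hae ▸ P.zero_mem : a ^ n * (1 - (a * r) ^ n) ∈ P) with h1 | h1
  · have ha := hPp.mem_of_pow_mem _ h1
    have h2 : (a * r) ^ n ∈ P := by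
      rw [mul_pow]
      exact P.mul_mem_right _ h1
    refine hPp.one_sub_notMem h2 ?_
    have := P.sub_mem ha haP'
    rwa [sub_sub_cancel] at this
  · have ha : a ∈ P := by
      have := P.add_mem haP' h1
      rwa [sub_add_cancel] at this
    have h2 := hPp.one_sub_notMem (s := 1 - (a * r) ^ n) h1
    rw [sub_sub_cancel] at h2
    rcases Nat.eq_zero_or_pos n with rfl | hn
    · rw [pow_zero, one_mul] at hr
      have : (1 : R) ∈ P := by
        have h3 : (1 : R) = a * r := by linear_combination hr
        rw [h3]
        exact P.mul_mem_right _ ha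
      exact hPp.ne_top ((Ideal.eq_top_iff_one _).2 this)
    · exact h2 (P.pow_mem_of_mem (P.mul_mem_right _ ha) n hn)

end DimensionZero

/-! ### Coherence and arithmeticity from quotients that are IF -/

section Necessary

variable {R : Type u} [CommRing R]

/-- If the primes containing `A` are maximal, the regular elements of `R ⧸ A` are units, so
`R ⧸ A` is its own ring of quotients. -/
theorem IsFinitelyFractionallyIF.hasAnnihilatorCondition (hR : IsFinitelyFractionallyIF R)
    {A : Ideal R} (hA : A.FG) (hmax : ∀ P : Ideal R, P.IsPrime → A ≤ P → P.IsMaximal) :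
    HasAnnihilatorCondition (R ⧸ A) := by
  have hmax' : ∀ P : Ideal (R ⧸ A), P.IsPrime → P.IsMaximal := by
    intro P hP
    have hAP : A ≤ P.comap (Ideal.Quotient.mk A) := fun y hy => by
      rw [Ideal.mem_comap, Ideal.Quotient.eq_zero_iff_mem.2 hy]
      exact P.zero_mem
    have := hmax _ (hP.comap (Ideal.Quotient.mk A)) hAP
    have hmap := Ideal.map_comap_of_surjective _ (Ideal.Quotient.mk_surjective (I := A)) P
    rcases Ideal.map_eq_top_or_isMaximal_of_surjective (Ideal.Quotient.mk A)
      Ideal.Quotient.mk_surjective this with h | h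
    · exact absurd (hmap.symm.trans h) hP.ne_top
    · exact hmap ▸ h
  have e := IsLocalization.atUnits (R ⧸ A) (nonZeroDivisors (R ⧸ A))
    (S := FractionRing (R ⧸ A)) fun z hz =>
      isUnit_of_mem_nonZeroDivisors_of_forall_isMaximal hmax' hz
  exact (hR A hA).hasAnnihilatorCondition.of_ringEquiv e.symm.toRingEquiv

/-- With `D = aR ∩ bR` finitely generated and `R ⧸ D` an IF-ring, the images of `aR` and `bR` in
`R ⧸ D` have zero intersection, so they have comaximal annihilators, which are `(bR : a)` and
`(aR : b)`. -/
theorem IsFinitelyFractionallyIF.exists_comparison (hR : IsFinitelyFractionallyIF R) {A : Ideal R}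
    (hA : A.FG) (hmax : ∀ P : Ideal R, P.IsPrime → A ≤ P → P.IsMaximal) {a b : R}
    (hab : A ≤ Ideal.span {a} ⊓ Ideal.span {b}) :
    ∃ s v w : R, s * a = v * b ∧ (1 - s) * b = w * a := by
  let D : Ideal R := Ideal.span {a} ⊓ Ideal.span {b}
  have hspan : ∀ (I : Ideal R) (c z : R), I ≤ Ideal.span {c} →
      Ideal.Quotient.mk I z ∈ Ideal.span {Ideal.Quotient.mk I c} → z ∈ Ideal.span {c} := by
    intro I c z hI hz
    obtain ⟨q, hq⟩ := Ideal.mem_span_singleton'.1 hz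
    obtain ⟨q, rfl⟩ := Ideal.Quotient.mk_surjective q
    rw [← map_mul, eq_comm, Ideal.Quotient.eq] at hq
    have := Ideal.add_mem _ (hI hq) (Ideal.mul_mem_left _ q (Ideal.mem_span_singleton_self c))
    rwa [sub_add_cancel] at this
  have hspan' : ∀ (I : Ideal R) (c z : R), z ∈ Ideal.span {c} →
      Ideal.Quotient.mk I z ∈ Ideal.span {Ideal.Quotient.mk I c} := by
    intro I c z hz
    obtain ⟨q, rfl⟩ := Ideal.mem_span_singleton'.1 hz
    exact Ideal.mem_span_singleton'.2 ⟨Ideal.Quotient.mk I q, (map_mul _ _ _).symm⟩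
  have hD : D.FG := by
    have h1 := (hR.hasAnnihilatorCondition hA hmax).span_inf_span_fg
      (Ideal.Quotient.mk A a) (Ideal.Quotient.mk A b)
    have h2 : D.map (Ideal.Quotient.mk A) =
        Ideal.span {Ideal.Quotient.mk A a} ⊓ Ideal.span {Ideal.Quotient.mk A b} := by
      ext z
      obtain ⟨z, rfl⟩ := Ideal.Quotient.mk_surjective z
      rw [Ideal.mem_quotient_iff_mem hab]
      exact ⟨fun hz => ⟨hspan' A a z hz.1, hspan' A b z hz.2⟩, fun hz =>
        ⟨hspan A a z (hab.trans inf_le_left) hz.1, hspan A b z (hab.trans inf_le_right) hz.2⟩⟩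
    rw [← h2] at h1
    have h3 : D = D ⊔ A := (sup_eq_left.2 hab).symm
    obtain ⟨F, hF⟩ := h1
    choose g hg using Ideal.Quotient.mk_surjective (I := A)
    have h4 : ∀ I : Ideal R, I ⊔ A = (I.map (Ideal.Quotient.mk A)).comap (Ideal.Quotient.mk A) :=
      fun I => by
        rw [Ideal.comap_map_of_surjective' _ Ideal.Quotient.mk_surjective, Ideal.mk_ker]
    have h5 : (Ideal.span (g '' F)).map (Ideal.Quotient.mk A) =
        D.map (Ideal.Quotient.mk A) := by
      rw [Ideal.map_span, Set.image_image]
      simp only [hg, Set.image_id', hF]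
    have h6 : D = Ideal.span (g '' F) ⊔ A := by rw [h4, h5, ← h4, ← h3]
    rw [h6]
    exact Submodule.FG.sup (Submodule.fg_span (F.finite_toSet.image g)) hA
  obtain ⟨c, hca, hcb⟩ := (hR.hasAnnihilatorCondition hD
    fun P hP hDP => hmax P hP (hab.trans hDP)).exists_mul_eq
      (a := Ideal.Quotient.mk D a) (b := Ideal.Quotient.mk D b) (by
        rw [eq_bot_iff]
        intro z hz
        obtain ⟨z, rfl⟩ := Ideal.Quotient.mk_surjective z
        exact Ideal.Quotient.eq_zero_iff_mem.2
          ⟨hspan D a z inf_le_left hz.1, hspan D b z inf_le_right hz.2⟩)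
  obtain ⟨c, rfl⟩ := Ideal.Quotient.mk_surjective c
  rw [← map_mul, eq_comm, Ideal.Quotient.eq] at hca
  rw [← map_mul, Ideal.Quotient.eq_zero_iff_mem] at hcb
  obtain ⟨v, hv⟩ := Ideal.mem_span_singleton'.1 hca.2
  obtain ⟨w, hw⟩ := Ideal.mem_span_singleton'.1 hcb.1
  exact ⟨1 - c, v, w, by linear_combination -hv, by linear_combination -hw⟩

/-- `I` is an extension of the finitely presented modules `I / A` and `A`. -/
theorem finitePresentation_of_isCoherentRing_quotient {A I : Ideal R} (hAI : A ≤ I) (hI : I.FG)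
    (hA : A.FG) [Module.FinitePresentation R A] (hRA : IsCoherentRing (R ⧸ A)) :
    Module.FinitePresentation R I := by
  let J := I.map (Ideal.Quotient.mk A)
  have : Module.FinitePresentation (R ⧸ A) J := hRA J (hI.map _)
  have : Module.FinitePresentation R (R ⧸ A) :=
    Module.finitePresentation_of_surjective A.mkQ A.mkQ_surjective (by rwa [Submodule.ker_mkQ])
  have : Module.FinitePresentation R J := Module.FinitePresentation.trans R J (R ⧸ A)
  let l : I →ₗ[R] J :=
    { toFun := fun x => ⟨Ideal.Quotient.mk A x, Ideal.mem_map_of_mem _ x.2⟩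
      map_add' := fun x y => rfl
      map_smul' := fun r x => rfl }
  have hl : Function.Surjective l := by
    rintro ⟨z, hz⟩
    obtain ⟨z, rfl⟩ := Ideal.Quotient.mk_surjective z
    exact ⟨⟨z, (Ideal.mem_quotient_iff_mem hAI).1 hz⟩, rfl⟩
  have hker : ∀ x : I, x ∈ LinearMap.ker l ↔ (x : R) ∈ A := fun x => by
    rw [LinearMap.mem_ker, ← Subtype.val_inj]
    exact Ideal.Quotient.eq_zero_iff_mem
  let e : A ≃ₗ[R] LinearMap.ker l :=
    { toFun := fun x => ⟨⟨x, hAI x.2⟩, (hker _).2 x.2⟩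
      invFun := fun x => ⟨x.1, (hker _).1 x.2⟩
      map_add' := fun x y => rfl
      map_smul' := fun r x => rfl
      left_inv := fun x => rfl
      right_inv := fun x => rfl }
  have : Module.FinitePresentation R (LinearMap.ker l) := Module.FinitePresentation.of_equiv e
  exact Module.finitePresentation_of_ker l hl

theorem IsFinitelyFractionallyIF.isLocallyComparable_and_isCoherentRing_of_forall_isMaximal
    (hR : IsFinitelyFractionallyIF R) (hmax : ∀ P : Ideal R, P.IsPrime → P.IsMaximal) :
    IsLocallyComparable R ∧ IsCoherentRing R := by
  have hbot : (⊥ : Ideal R).FG := Submodule.fg_bot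
  refine ⟨fun a b => hR.exists_comparison hbot (fun P hP _ => hmax P hP) bot_le, fun I hI => ?_⟩
  exact finitePresentation_of_isCoherentRing_quotient bot_le hI hbot
    (hR.hasAnnihilatorCondition hbot fun P hP _ => hmax P hP).isCoherentRing

/-- In a domain of dimension at most one, the preceding criteria apply to the principal ideals
generated by a nonzero element, which are free. -/
theorem IsFinitelyFractionallyIF.isLocallyComparable_and_isCoherentRing_of_isDomain [IsDomain R]
    (hR : IsFinitelyFractionallyIF R)
    (hmax : ∀ P : Ideal R, P.IsPrime → P ≠ ⊥ → P.IsMaximal) :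
    IsLocallyComparable R ∧ IsCoherentRing R := by
  have hfg : ∀ r : R, (Ideal.span {r}).FG := fun r => Submodule.fg_span (Set.finite_singleton r)
  have hmax' : ∀ r : R, r ≠ 0 → ∀ P : Ideal R, P.IsPrime → Ideal.span {r} ≤ P → P.IsMaximal := by
    intro r hr P hP hrP
    refine hmax P hP ?_
    rintro rfl
    exact hr ((Submodule.mem_bot R).1 (hrP (Ideal.mem_span_singleton_self r)))
  constructor
  · intro a b
    by_cases ha : a = 0
    · exact ⟨1, 0, 0, by simp [ha], by simp⟩
    by_cases hb : b = 0
    · exact ⟨0, 0, 0, by simp, by simp [hb]⟩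
    refine hR.exists_comparison (hfg (a * b)) (hmax' _ (mul_ne_zero ha hb)) (le_inf ?_ ?_)
    · exact Ideal.span_singleton_le_span_singleton.2 (dvd_mul_right a b)
    · exact Ideal.span_singleton_le_span_singleton.2 (dvd_mul_left b a)
  · intro I hI
    by_cases hI0 : I = ⊥
    · subst hI0
      infer_instance
    obtain ⟨r, hrI, hr⟩ := Submodule.exists_mem_ne_zero_of_ne_bot hI0
    have : Module.FinitePresentation R (Ideal.span {r}) :=
      Module.FinitePresentation.of_equiv (LinearEquiv.toSpanNonzeroSingleton R R r hr)
    exact finitePresentation_of_isCoherentRing_quotient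
      ((Ideal.span_singleton_le_iff_mem I).2 hrI) hI (hfg r)
      (hR.hasAnnihilatorCondition (hfg r) (hmax' r hr)).isCoherentRing

end Necessary

/-! ### Domains, and the four assertions -/

/-- In a domain, `0` is the only minimal prime, so `A(x) = 0`. -/
theorem isFinitelyFractionallyIF_of_isDomain {R : Type u} [CommRing R] [IsDomain R]
    (hcoh : IsCoherentRing R) (hR : IsLocallyComparable R) : IsFinitelyFractionallyIF R := by
  refine isFinitelyFractionallyIF_of_isAlmostCleanRing (fun a => ?_) hcoh hR fun x => ?_
  · by_cases ha : a = 0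
    · exact ⟨1, -1, IsIdempotentElem.one, mem_nonZeroDivisors_of_ne_zero (by simp), by simp [ha]⟩
    · exact ⟨0, a, IsIdempotentElem.zero, mem_nonZeroDivisors_of_ne_zero ha, by simp⟩
  · obtain ⟨N, hN, hNx⟩ := hR.exists_minimalPrime x
    have hbot : (⊥ : Ideal R).IsPrime := Ideal.isPrime_bot
    have h0 : pureIdealAt x = ⊥ :=
      le_bot_iff.1 ((pureIdealAt_le hN.1.1 hNx).trans (hN.2 ⟨hbot, le_rfl⟩ bot_le))
    exact Or.inr (Or.inr ((Ideal.Quotient.isDomain_iff_prime _).2 (h0 ▸ hbot)))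

theorem theorem5p9 :
    (∀ (R : Type u) [CommRing R],
      IsAlmostCleanRing R → IsCoherentRing R → IsArithmeticalRing R →
      (∀ x : PSpec R, IsTorchRing (R ⧸ pureIdealAt x) ∨ IsLocalRing (R ⧸ pureIdealAt x) ∨
        IsDomain (R ⧸ pureIdealAt x)) →
      IsFinitelyFractionallyIF R) ∧
    (∀ (R : Type u) [CommRing R],
      IsCleanRing R → IsCoherentRing R → IsArithmeticalRing R → IsFinitelyFractionallyIF R) ∧
    (∀ (R : Type u) [CommRing R], IsSemihereditaryRing R → IsFinitelyFractionallyIF R) ∧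
    (∀ (R : Type u) [CommRing R],
      (ringKrullDim R = 0 ∨ (IsDomain R ∧ ringKrullDim R = 1)) →
      (IsFinitelyFractionallyIF R ↔ IsCoherentRing R ∧ IsArithmeticalRing R)) := by
  refine ⟨fun R _ hac hcoh hR hx =>
      isFinitelyFractionallyIF_of_isAlmostCleanRing hac hcoh hR.isLocallyComparable hx,
    fun R _ h hcoh hR => h.isFinitelyFractionallyIF hcoh hR.isLocallyComparable,
    fun R _ h => h.isFinitelyFractionallyIF, ?_⟩
  rintro R _ (h0 | ⟨hdom, h1⟩)
  · have hmax := Ring.krullDimLE_zero_iff.1 (Ring.krullDimLE_iff.2 h0.le)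
    refine ⟨fun h => ?_, fun h => (isCleanRing_of_forall_isMaximal hmax).isFinitelyFractionallyIF
      h.1 h.2.isLocallyComparable⟩
    obtain ⟨hR, hcoh⟩ :=
      h.isLocallyComparable_and_isCoherentRing_of_forall_isMaximal hmax
    exact ⟨hcoh, hR.isArithmeticalRing⟩
  · have hmax : ∀ P : Ideal R, P.IsPrime → P ≠ ⊥ → P.IsMaximal := fun P hP hP0 =>
      Ring.krullDimLE_one_iff_of_isPrime_bot.1 (Ring.krullDimLE_iff.2 h1.le) P hP0 hP
    refine ⟨fun h => ?_, fun h =>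
      isFinitelyFractionallyIF_of_isDomain h.1 h.2.isLocallyComparable⟩
    obtain ⟨hR, hcoh⟩ := h.isLocallyComparable_and_isCoherentRing_of_isDomain hmax
    exact ⟨hcoh, hR.isArithmeticalRing⟩
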